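/- Let $d\ge 2$, let $\omega$ be the surface measure on the unit sphere $\mathbb S^{d-1}\subset\mathbb R^d$, and for $\mu\in\mathbb S^{d-1}$, $\kappa\ge 0$ let $f(x;\mu,\kappa)=c_d(\kappa)e^{\kappa\mu^Tx}$ be the von Mises–Fisher density with respect to $\omega$, where $c_d(\kappa)=\frac{\kappa^{d/2-1}}{(2\pi)^{d/2}I_{d/2-1}(\kappa)}$ for $\kappa>0$ ($I_r$ the modified Bessel function of the first kind) and $c_d(0)=1/\omega(\mathbb S^{d-1})$. For $p\ge 1$ let $\Gamma=\Pi\times(\mathbb S^{d-1}\times[0,\infty))^p$, where $\Pi$ is the set of $(\pi_1,\dots,\pi_p)$ with $\pi_k\ge 0$ and $\sum_k\pi_k=1$. A point $\gamma=((\pi_k)_k,(\mu_k,\kappa_k)_k)\in\Gamma$ has mixture density $f_\gamma=\sum_{k=1}^p\pi_kf(\cdot;\mu_k,\kappa_k)$. Let $\tilde\Gamma$ be the quotient topological space of $\Gamma$ obtained by identifying parameters whose densities are equal $\omega$-almost everywhere. Let $\gamma_0\in\Gamma$ be such that $f_{\gamma_0}$ is a genuine $p$-component mixture, i.e. it is not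 almost everywhere equal to a mixture of fewer than $p$ von Mises–Fisher densities. Let $X_1,X_2,\dots$ be i.i.d. with density $f_{\gamma_0}$. Put $M=\max_{x}f_{\gamma_0}(x)$ and $A_2=2^{d-1}\,\frac{2\pi^{(d-1)/2}}{\Gamma((d-1)/2)}$ (here $\Gamma(\cdot)$ is the gamma function). Let $p_n$ be penalty functions of $\boldsymbol\kappa=(\kappa_1,\dots,\kappa_p)\in[0,\infty)^p$ such that, for some functions $\tilde p_n:[0,\infty)\to\mathbb R$: C1. $p_n(\boldsymbol\kappa)=\sum_{l=1}^p\tilde p_n(\kappa_l)$; C2. $\sup_{\kappa>0}\max\{0,\tilde p_n(\kappa)\}=o(n)$, and $\tilde p_n(\kappa)=o(n)$ for each fixed $\kappa\ge 0$; C3. for all sufficiently large $n$, $\tilde p_n(\kappa)\le-3(\log n)^2\log\kappa$ for every $\kappa>1$ with $\frac1{(\log\kappa)^{2d-2}}\le\frac{\log n}{MnA_2}$. Let $pl_n(\gamma)=\sum_{i=1}^n\log f_\gamma(X_i)+p_n(\boldsymbol\kappa)$. If, almost surely, $\hat\gamma_n$ is a maximizer of $pl_n$ over $\Gamma$ for all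 sufficiently large $n$, then almost surely $\hat\gamma_n\to\gamma_0$ in $\tilde\Gamma$ as $n\to\infty$. -/

import Mathlib

open MeasureTheory ProbabilityTheory Filter Topology Asymptotics
open scoped NNReal ENNReal

noncomputable section

namespace VMF

/-- The unit sphere of `ℝ^d` with the Euclidean norm. -/
abbrev Sphere (d : ℕ) : Type := Metric.sphere (0 : EuclideanSpace ℝ (Fin d)) 1

/-- The standard (unnormalized) surface measure on the unit sphere of `ℝ^d`. -/
def surface (d : ℕ) : Measure (Sphere d) :=
  (volume : Measure (EuclideanSpace ℝ (Fin d))).toSphere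

/-- The modified Bessel function of the first kind of order `r`, by its power series
(for `z > 0`). -/
def besselI (r z : ℝ) : ℝ :=
  ∑' m : ℕ, (z / 2) ^ (2 * (m : ℝ) + r) / ((m.factorial : ℝ) * Real.Gamma ((m : ℝ) + r + 1))

/-- The normalizing constant of the von Mises-Fisher density. At concentration `0`, where the
Bessel formula reads `0 / 0` for `d > 2`, it is the constant of the uniform distribution. -/
def normConst (d : ℕ) (κ : ℝ≥0) : ℝ :=
  if κ = 0 then ((surface d).real Set.univ)⁻¹
  else (κ : ℝ) ^ ((d : ℝ) / 2 - 1) /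
    ((2 * Real.pi) ^ ((d : ℝ) / 2) * besselI ((d : ℝ) / 2 - 1) (κ : ℝ))

/-- Parameters `(μ, κ)` of one component: a mean direction and a concentration `κ ≥ 0`. -/
abbrev Component (d : ℕ) : Type := Sphere d × ℝ≥0

/-- The von Mises-Fisher density with respect to the surface measure. -/
def density {d : ℕ} (θ : Component d) (x : Sphere d) : ℝ :=
  normConst d θ.2 *
    Real.exp ((θ.2 : ℝ) * inner ℝ (θ.1 : EuclideanSpace ℝ (Fin d)) (x : EuclideanSpace ℝ (Fin d)))

/-- The parameter space of `p`-component mixtures: mixing proportions (nonnegative, with sum `1`)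
and the parameters of the `p` components, with the product topology. -/
abbrev Param (d p : ℕ) : Type := stdSimplex ℝ (Fin p) × (Fin p → Component d)

/-- The mixture density. -/
def mixDensity {d p : ℕ} (γ : Param d p) (x : Sphere d) : ℝ :=
  ∑ k, (γ.1 : Fin p → ℝ) k * density (γ.2 k) x

/-- The distribution on the sphere with density `mixDensity γ`. -/
def mixMeasure {d p : ℕ} (γ : Param d p) : Measure (Sphere d) :=
  (surface d).withDensity fun x => ENNReal.ofReal (mixDensity γ x)

/-- Two parameters are identified when their mixture densities agree almost everywhere. -/
instance paramSetoid (d p : ℕ) : Setoid (Param d p) where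
  r γ γ' := mixDensity γ =ᵐ[surface d] mixDensity γ'
  iseqv := ⟨fun _ => ae_eq_refl _, fun h => h.symm, fun h h' => h.trans h'⟩

/-- The quotient space of the parameter space, with the quotient topology. -/
abbrev QuotParam (d p : ℕ) : Type := Quotient (paramSetoid d p)

/-- The mixture has exactly `p` components: its density is not that of a mixture of fewer
than `p` von Mises-Fisher distributions. -/
def HasExactOrder {d p : ℕ} (γ : Param d p) : Prop :=
  ∀ q : ℕ, q < p → ∀ γ' : Param d q, ¬ (mixDensity γ =ᵐ[surface d] mixDensity γ')

/-- The log-likelihood of the first `n` observations of the sequence `x`. -/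
def logLik {d p : ℕ} (x : ℕ → Sphere d) (n : ℕ) (γ : Param d p) : ℝ :=
  ∑ i ∈ Finset.range n, Real.log (mixDensity γ (x i))

/-- The penalized log-likelihood, for the penalty functions `pen n` of `(κ_1, …, κ_p)`. -/
def penLogLik {d p : ℕ} (pen : ℕ → (Fin p → ℝ≥0) → ℝ) (x : ℕ → Sphere d) (n : ℕ)
    (γ : Param d p) : ℝ :=
  logLik x n γ + pen n fun l => (γ.2 l).2

/-- The maximum of the mixture density over the (compact) sphere. -/
def maxDensity {d p : ℕ} (γ : Param d p) : ℝ := ⨆ x : Sphere d, mixDensity γ x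

/-- The constant `A₂ = 2^{d-1} · 2 π^{(d-1)/2} / Γ((d-1)/2)` (for `d ≥ 2`). -/
def constA (d : ℕ) : ℝ :=
  2 ^ (d - 1) * (2 * Real.pi ^ (((d : ℝ) - 1) / 2) / Real.Gamma (((d : ℝ) - 1) / 2))

/-- C1: the penalty is additive in the concentrations. -/
def CondC1 {p : ℕ} (pen : ℕ → (Fin p → ℝ≥0) → ℝ) (pt : ℕ → ℝ≥0 → ℝ) : Prop :=
  ∀ n κ, pen n κ = ∑ l, pt n (κ l)

/-- C2: the supremum over `κ > 0` of the positive part of the penalty is (finite for large `n`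
and) `o(n)`, and the penalty at each fixed `κ ≥ 0` is `o(n)`. -/
def CondC2 (pt : ℕ → ℝ≥0 → ℝ) : Prop :=
  ((∀ᶠ n in atTop, BddAbove (Set.range fun κ : {κ : ℝ≥0 // 0 < κ} => max 0 (pt n κ))) ∧
    (fun n : ℕ => ⨆ κ : {κ : ℝ≥0 // 0 < κ}, max 0 (pt n κ)) =o[atTop] fun n : ℕ => (n : ℝ)) ∧
  ∀ κ : ℝ≥0, (fun n : ℕ => pt n κ) =o[atTop] fun n : ℕ => (n : ℝ)

/-- C3: for all large `n`, the penalty is at most `-3 (log n)² log κ` for every `κ > 1` with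
`1 / (log κ)^{2d-2} ≤ log n / (M n A₂)`. -/
def CondC3 (d : ℕ) (M : ℝ) (pt : ℕ → ℝ≥0 → ℝ) : Prop :=
  ∀ᶠ n : ℕ in atTop, ∀ κ : ℝ≥0, 1 < κ →
    1 / Real.log κ ^ (2 * d - 2) ≤ Real.log n / (M * n * constA d) →
    pt n κ ≤ -3 * Real.log n ^ 2 * Real.log κ

end VMF

end

/-! This is Wald's consistency argument; the penalty tames the unbounded likelihood as a
concentration `κ` tends to infinity. If convergence fails, some ultrafilter follows estimators that
avoid a neighbourhood of the true class. Along it weights and directions converge by compactness,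
and each concentration converges or diverges. The non-diverging components converge uniformly to a
sub-mixture `g` of mass at most one. Once the diverging components are known to gain at most `o(n)`,
comparison with `γ₀` and the law of large numbers give `∫ f₀ log f₀ ≤ ∫ f₀ log (ε + g)` for every `ε
> 0`. A Hellinger form of Gibbs' inequality (`ae_eq_of_integral_mul_log_le`) then yields `g = f₀`
almost everywhere. Exact order rules out a missing component, so the limit parameter lies in the
class of `γ₀`, a contradiction (`tendsto_of_isMax`).

The main work is `exists_eventually_tail_le`. A component of concentration `κ ≈ 2 ^ (32 j)` is at
most of order `κ ^ d`, and is negligible outside a cap of radius of order `κ ^ (-1/4)`. By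
`ae_card_ball_le` such a cap contains at most `1 + C n 2⁻ʲ` observations, whatever its centre. The
gain is therefore at most about `(d + 1) log κ` plus `n` times a multiple of `(j + 1) 2⁻ʲ`. The
second term is small for large `κ`; the penalty absorbs the first (`eventually_mul_log_add_le`). The
count rests on a second-moment bound for pairs of close observations and on Borel-Cantelli. -/

namespace VMF

/-! ### Normalizing constant: spherical moments from Gaussian moments, and the Bessel series. -/

section Normalization

variable {d : ℕ}

instance : IsFiniteMeasure (surface d) := by unfold surface; infer_instance

/-- The Gaussian weight `exp (-‖y‖² / 2)` as a measure on `ℝ^d`. -/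
noncomputable def gaussianWeight (d : ℕ) : Measure (EuclideanSpace ℝ (Fin d)) :=
  volume.withDensity fun y => ENNReal.ofReal (Real.exp (-‖y‖ ^ 2 / 2))

lemma integral_gaussianWeight (f : EuclideanSpace ℝ (Fin d) → ℝ) :
    ∫ y, f y ∂(gaussianWeight d) = ∫ y, f y * Real.exp (-‖y‖ ^ 2 / 2) := by
  rw [gaussianWeight, integral_withDensity_eq_integral_toReal_smul (by fun_prop) (by simp)]
  refine integral_congr_ae (.of_forall fun y => ?_)
  simp [ENNReal.toReal_ofReal (Real.exp_nonneg _), mul_comm]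

/-- Up to the total mass this is the moment generating function of a standard normal variable, so
linear functionals have one-dimensional normal moments. Compared with polar coordinates, this gives
the moments of the sphere. -/
lemma mgf_inner_gaussianWeight (μ : Sphere d) (t : ℝ) :
    mgf (fun y => inner ℝ (μ : EuclideanSpace ℝ (Fin d)) y) (gaussianWeight d) t =
      (2 * Real.pi) ^ ((d : ℝ) / 2) * Real.exp (t ^ 2 / 2) := by
  rw [mgf, integral_gaussianWeight]
  have h := GaussianFourier.integral_cexp_neg_mul_sq_norm_add (b := 1 / 2) (by norm_num) (t : ℂ)
    (μ : EuclideanSpace ℝ (Fin d))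
  rw [← Complex.ofReal_inj, ← integral_complex_ofReal]
  have hμ : ‖(μ : EuclideanSpace ℝ (Fin d))‖ = 1 := by simp
  have e1 : ∀ y : EuclideanSpace ℝ (Fin d),
      ((Real.exp (t * inner ℝ (μ : EuclideanSpace ℝ (Fin d)) y) * Real.exp (-‖y‖ ^ 2 / 2) : ℝ) : ℂ)
      = Complex.exp (-(1 / 2) * (‖y‖ : ℂ) ^ 2 + t * (inner ℝ (μ : EuclideanSpace ℝ (Fin d)) y : ℝ)) := by
    intro y
    rw [← Real.exp_add]
    push_cast
    congr 1
    ring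
  simp_rw [e1, h, hμ]
  push_cast
  rw [Complex.ofReal_cpow (by positivity)]
  simp only [finrank_euclideanSpace, Fintype.card_fin]
  push_cast
  congr 2 <;> ring_nf

lemma integrableExpSet_inner_gaussianWeight (μ : Sphere d) :
    integrableExpSet (fun y => inner ℝ (μ : EuclideanSpace ℝ (Fin d)) y) (gaussianWeight d)
      = Set.univ := by
  ext t
  simp only [integrableExpSet, Set.mem_ofPred_eq, Set.mem_univ, iff_true]
  have h := mgf_inner_gaussianWeight μ t
  -- Without integrability the integral would take its default value `0`, whereas the closed formula
  -- is positive.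
  by_contra hn
  rw [mgf, integral_undef hn] at h
  have : 0 < (2 * Real.pi) ^ ((d : ℝ) / 2) * Real.exp (t ^ 2 / 2) := by positivity
  linarith

lemma integral_inner_pow_gaussianWeight (μ : Sphere d) (n : ℕ) :
    ∫ y, inner ℝ (μ : EuclideanSpace ℝ (Fin d)) y ^ n ∂(gaussianWeight d) =
      (2 * Real.pi) ^ ((d : ℝ) / 2) * ∫ x, x ^ n ∂(gaussianReal 0 1) := by
  have h1 := iteratedDeriv_mgf_zero (μ := gaussianWeight d)
    (X := fun y => inner ℝ (μ : EuclideanSpace ℝ (Fin d)) y)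
    (by simp [integrableExpSet_inner_gaussianWeight]) n
  have h2 := iteratedDeriv_mgf_zero (μ := gaussianReal 0 1) (X := id) (by simp) n
  have h3 : mgf (fun y => inner ℝ (μ : EuclideanSpace ℝ (Fin d)) y) (gaussianWeight d) =
      fun t => (2 * Real.pi) ^ ((d : ℝ) / 2) * mgf id (gaussianReal 0 1) t := by
    ext t
    rw [mgf_inner_gaussianWeight, mgf_id_gaussianReal]
    simp
  rw [h3, iteratedDeriv_const_mul_field, h2] at h1
  simpa using h1.symm

/-- The even moments of the standard normal distribution. -/
lemma integral_pow_two_mul_gaussianReal (m : ℕ) :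
    ∫ x, x ^ (2 * m) ∂(gaussianReal 0 1) = ((2 * m).factorial : ℝ) / (2 ^ m * m.factorial) := by
  rw [integral_gaussianReal_eq_integral_smul (by norm_num)]
  have h := integral_rpow_mul_exp_neg_mul_rpow (p := 2) (q := ((2 * m : ℕ) : ℝ)) (b := 1 / 2)
      (by norm_num) (by
        have : (0 : ℝ) ≤ ((2 * m : ℕ) : ℝ) := by positivity
        linarith) (by norm_num)
  have e1 : ∀ x : ℝ, gaussianPDFReal 0 1 x • x ^ (2 * m) =
      (√(2 * Real.pi))⁻¹ * (fun y : ℝ => y ^ ((2 * m : ℕ) : ℝ) * Real.exp (-(1 / 2) * y ^ (2 : ℝ))) |x| := by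
    intro x
    simp only [gaussianPDFReal_def, smul_eq_mul, Real.rpow_natCast, Real.rpow_two, sq_abs,
      Even.pow_abs (even_two_mul m)]
    norm_num
    ring_nf
  have e0 := integral_comp_abs
    (f := fun y : ℝ => y ^ ((2 * m : ℕ) : ℝ) * Real.exp (-(1 / 2) * y ^ (2 : ℝ)))
  rw [integral_congr_ae (.of_forall e1), integral_const_mul, e0, h]
  have e2 : (((2 * m : ℕ) : ℝ) + 1) / 2 = m + 1 / 2 := by push_cast; ring
  have e3 : (1 / 2 : ℝ) ^ (-(((2 * m : ℕ) : ℝ) + 1) / 2) = 2 ^ m * √2 := by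
    rw [neg_div, e2, one_div, Real.inv_rpow (by norm_num), Real.rpow_neg (by norm_num), inv_inv,
      Real.rpow_add (by norm_num), Real.rpow_natCast, Real.sqrt_eq_rpow, one_div]
  rw [e3, e2, Real.Gamma_nat_add_half, Real.sqrt_mul (by norm_num)]
  have e4 : ((2 * m).factorial : ℝ) = (2 ^ m * m.factorial) * (Nat.doubleFactorial (2 * m - 1)) := by
    rcases m with _ | k
    · simp
    · have h1 := Nat.factorial_eq_mul_doubleFactorial (2 * k + 1)
      rw [show 2 * k + 1 + 1 = 2 * (k + 1) by ring, Nat.doubleFactorial_two_mul] at h1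
      rw [h1]
      push_cast
      simp [mul_add]
  rw [e4]
  field_simp

lemma integral_pow_odd_gaussianReal (m : ℕ) :
    ∫ x, x ^ (2 * m + 1) ∂(gaussianReal 0 1) = 0 := by
  have h : (gaussianReal 0 1).map (fun x => -x) = gaussianReal 0 1 := by
    simpa using gaussianReal_map_neg (μ := 0) (v := 1)
  have h2 : ∫ x, x ^ (2 * m + 1) ∂(gaussianReal 0 1) = - ∫ x, x ^ (2 * m + 1) ∂(gaussianReal 0 1) := by
    conv_lhs => rw [← h, integral_map (by fun_prop) (by fun_prop)]
    rw [← integral_neg]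
    refine integral_congr_ae (.of_forall fun x => ?_)
    exact Odd.neg_pow (by simp) x
  linarith

/-- Polar coordinates for the moments of the Gaussian weight. -/
lemma integral_inner_pow_gaussianWeight_polar (hd : 2 ≤ d) (μ : Sphere d) (n : ℕ) :
    ∫ y, inner ℝ (μ : EuclideanSpace ℝ (Fin d)) y ^ n ∂(gaussianWeight d) =
      (∫ x : Sphere d, inner ℝ (μ : EuclideanSpace ℝ (Fin d)) (x : EuclideanSpace ℝ (Fin d)) ^ n
        ∂(surface d)) * (2 ^ (((n : ℝ) + d) / 2 - 1) * Real.Gamma (((n : ℝ) + d) / 2)) := by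
  have : Nonempty (Fin d) := ⟨⟨0, by omega⟩⟩
  set E := EuclideanSpace ℝ (Fin d)
  have hdim : Module.finrank ℝ E = d := by simp [E]
  rw [integral_gaussianWeight]
  set F : E → ℝ := fun y => inner ℝ (μ : E) y ^ n * Real.exp (-‖y‖ ^ 2 / 2) with hF
  have e1 : ∫ y, F y = ∫ y : ({(0)}ᶜ : Set E), F y ∂(volume.comap (Subtype.val : _ → E)) := by
    rw [integral_subtype_comap (measurableSet_singleton _).compl fun x ↦ F x,
        restrict_compl_singleton]
  -- The integrand is homogeneous of degree `n` times a radial function, so in polar coordinates it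
  -- is a product.
  have e2 := (volume : Measure E).measurePreserving_homeomorphUnitSphereProd.integral_comp
        (Homeomorph.measurableEmbedding _) (fun p : Metric.sphere (0 : E) 1 × Set.Ioi (0 : ℝ) =>
          inner ℝ (μ : E) (p.1 : E) ^ n * ((p.2 : ℝ) ^ n * Real.exp (-(p.2 : ℝ) ^ 2 / 2)))
  rw [integral_prod_mul (fun x : Metric.sphere (0 : E) 1 => inner ℝ (μ : E) (x : E) ^ n)
    (fun r : Set.Ioi (0 : ℝ) => ((r : ℝ) ^ n * Real.exp (-(r : ℝ) ^ 2 / 2)))] at e2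
  rw [e1, surface]
  convert e2 using 1
  · refine integral_congr_ae (.of_forall fun y => ?_)
    have hy : ‖(y : E)‖ ≠ 0 := norm_ne_zero_iff.2 y.2
    simp only [hF, homeomorphUnitSphereProd_apply_fst_coe, homeomorphUnitSphereProd_apply_snd_coe,
      real_inner_smul_right]
    rw [← mul_assoc, ← mul_pow]
    congr 2
    field_simp
  · congr 1
    simp only [Measure.volumeIoiPow, ENNReal.ofReal]
    rw [integral_withDensity_eq_integral_smul (by fun_prop),
      integral_subtype_comap measurableSet_Ioi fun a : ℝ ↦ Real.toNNReal (a ^ (Module.finrank ℝ E - 1)) •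
        (a ^ n * Real.exp (-a ^ 2 / 2))]
    have h := integral_rpow_mul_exp_neg_mul_rpow (p := 2) (q := (n : ℝ) + d - 1) (b := 1 / 2)
      (by norm_num) (by
        have : (2 : ℝ) ≤ d := by exact_mod_cast hd
        have : (0 : ℝ) ≤ n := by positivity
        linarith) (by norm_num)
    have e3 : (2 : ℝ) ^ (((n : ℝ) + d) / 2 - 1) * Real.Gamma (((n : ℝ) + d) / 2) =
        (1 / 2 : ℝ) ^ (-((n : ℝ) + d - 1 + 1) / 2) * (1 / 2) * Real.Gamma (((n : ℝ) + d - 1 + 1) / 2) := by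
      rw [Real.rpow_sub_one (by norm_num), one_div, Real.inv_rpow (by norm_num),
        ← Real.rpow_neg (by norm_num)]
      ring_nf
    rw [e3, ← h]
    refine setIntegral_congr_fun measurableSet_Ioi fun x hx => ?_
    have hx0 : (0 : ℝ) < x := hx
    simp only [NNReal.smul_def, smul_eq_mul]
    rw [Real.coe_toNNReal _ (by positivity), hdim, ← mul_assoc, ← pow_add]
    have e4 : (n : ℝ) + d - 1 = ((d - 1 + n : ℕ) : ℝ) := by
      rw [Nat.cast_add, Nat.cast_sub (by omega)]; push_cast; ring
    rw [e4, Real.rpow_natCast, Real.rpow_two]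
    ring_nf

lemma integrable_of_continuous_surface {f : Sphere d → ℝ} (hf : Continuous f) :
    Integrable f (surface d) := by
  exact hf.integrable_of_hasCompactSupport (HasCompactSupport.of_compactSpace f)

lemma abs_inner_sphere_le (μ x : Sphere d) :
    |inner ℝ (μ : EuclideanSpace ℝ (Fin d)) (x : EuclideanSpace ℝ (Fin d))| ≤ 1 := by
  simpa using abs_real_inner_le_norm (μ : EuclideanSpace ℝ (Fin d)) (x : EuclideanSpace ℝ (Fin d))

/-- Termwise integration of the exponential series, dominated by `|κ| ^ n / n!` because the inner
product is at most one in absolute value. -/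
lemma hasSum_integral_exp_inner (μ : Sphere d) (κ : ℝ) :
    HasSum (fun n : ℕ => κ ^ n / n.factorial *
      ∫ x : Sphere d, inner ℝ (μ : EuclideanSpace ℝ (Fin d)) (x : EuclideanSpace ℝ (Fin d)) ^ n
        ∂(surface d))
      (∫ x : Sphere d, Real.exp (κ * inner ℝ (μ : EuclideanSpace ℝ (Fin d))
        (x : EuclideanSpace ℝ (Fin d))) ∂(surface d)) := by
  set u : Sphere d → ℝ := fun x => inner ℝ (μ : EuclideanSpace ℝ (Fin d))
    (x : EuclideanSpace ℝ (Fin d)) with hu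
  have huc : Continuous u := by fun_prop
  have hi : ∀ n : ℕ, Integrable (fun x => (κ * u x) ^ n / (n.factorial : ℝ)) (surface d) :=
    fun n => integrable_of_continuous_surface (by fun_prop)
  have h := hasSum_integral_of_summable_integral_norm hi (by
    refine Summable.of_nonneg_of_le (fun n => integral_nonneg fun _ => norm_nonneg _) (fun n => ?_)
      ((Real.summable_pow_div_factorial |κ|).mul_right ((surface d).real Set.univ))
    calc ∫ x, ‖(κ * u x) ^ n / (n.factorial : ℝ)‖ ∂(surface d)
        ≤ ∫ _, |κ| ^ n / (n.factorial : ℝ) ∂(surface d) := by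
          refine integral_mono (hi n).norm (integrable_const _) fun x => ?_
          simp only [norm_div, norm_pow, norm_mul, Real.norm_eq_abs, Nat.abs_cast]
          gcongr
          exact mul_le_of_le_one_right (abs_nonneg _) (abs_inner_sphere_le μ x)
      _ = _ := by simp [mul_comm])
  have e1 : ∀ x : Sphere d, ∑' n : ℕ, (κ * u x) ^ n / (n.factorial : ℝ) = Real.exp (κ * u x) := by
    intro x
    rw [Real.exp_eq_exp_ℝ, NormedSpace.exp_eq_tsum_div]
  simp_rw [e1] at h
  have e2 : ∀ n : ℕ, ∫ x, (κ * u x) ^ n / (n.factorial : ℝ) ∂(surface d) =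
      κ ^ n / n.factorial * ∫ x, u x ^ n ∂(surface d) := by
    intro n
    rw [← integral_const_mul]
    refine integral_congr_ae (.of_forall fun x => ?_)
    simp only []
    ring
  simp_rw [e2] at h
  exact h

/-- The Laplace transform of the surface measure of the sphere is a Bessel function. -/
lemma integral_exp_inner_eq_besselI (hd : 2 ≤ d) (μ : Sphere d) {κ : ℝ} (hκ : 0 < κ) :
    κ ^ ((d : ℝ) / 2 - 1) * ∫ x : Sphere d, Real.exp (κ * inner ℝ (μ : EuclideanSpace ℝ (Fin d))
        (x : EuclideanSpace ℝ (Fin d))) ∂(surface d) =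
      (2 * Real.pi) ^ ((d : ℝ) / 2) * besselI ((d : ℝ) / 2 - 1) κ := by
  have hd' : (0 : ℝ) < d := by exact_mod_cast (by omega : 0 < d)
  have hmom : ∀ n : ℕ, _ := fun n => (integral_inner_pow_gaussianWeight_polar hd μ n).symm.trans
    (integral_inner_pow_gaussianWeight μ n)
  have hpos : ∀ n : ℕ, 0 < (2 : ℝ) ^ (((n : ℝ) + d) / 2 - 1) * Real.Gamma (((n : ℝ) + d) / 2) := by
    intro n
    have := Real.Gamma_pos_of_pos (show 0 < ((n : ℝ) + d) / 2 by positivity)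
    positivity
  have h := hasSum_integral_exp_inner μ κ
  have hinj : Function.Injective fun m : ℕ => 2 * m := fun a b hab => by simpa using hab
  rw [← hinj.hasSum_iff] at h
  swap
  · intro n hn
    obtain ⟨m, rfl⟩ : ∃ m, n = 2 * m + 1 := by
      rcases Nat.even_or_odd' n with ⟨m, hm | hm⟩
      · exact absurd ⟨m, hm.symm⟩ hn
      · exact ⟨m, hm⟩
    have h1 := hmom (2 * m + 1)
    rw [integral_pow_odd_gaussianReal, mul_zero] at h1
    rw [(mul_eq_zero.1 h1).resolve_right (hpos _).ne', mul_zero]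
  rw [← h.tsum_eq, besselI, ← tsum_mul_left, ← tsum_mul_left]
  congr 1
  ext m
  have h1 := hmom (2 * m)
  rw [integral_pow_two_mul_gaussianReal] at h1
  have e1 : (((2 * m : ℕ) : ℝ) + d) / 2 = m + d / 2 := by push_cast; ring
  have hp := hpos (2 * m)
  rw [e1] at h1 hp
  have hG : 0 < Real.Gamma ((m : ℝ) + d / 2) := Real.Gamma_pos_of_pos (by positivity)
  rw [← eq_div_iff hp.ne'] at h1
  simp only [Function.comp]
  rw [h1]
  have e2 : (m : ℝ) + ((d : ℝ) / 2 - 1) + 1 = m + d / 2 := by ring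
  have e3 : (m : ℝ) + d / 2 - 1 = m + ((d : ℝ) / 2 - 1) := by ring
  rw [e2, e3, Real.div_rpow hκ.le (by norm_num), Real.rpow_add hκ, Real.rpow_add (by norm_num),
    Real.rpow_add (by norm_num), Real.rpow_natCast, ← Nat.cast_ofNat, ← Nat.cast_mul,
    Real.rpow_natCast, Real.rpow_natCast, pow_mul (((2 : ℕ) : ℝ))]
  have hf : ((2 * m).factorial : ℝ) ≠ 0 := by positivity
  have hf' : (m.factorial : ℝ) ≠ 0 := by positivity
  have h2 : ((2 : ℕ) : ℝ) ^ ((d : ℝ) / 2 - 1) ≠ 0 := by positivity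
  field_simp
  simp only [Nat.cast_ofNat]
  exact pow_right_comm 2 2 m

/-- The von Mises-Fisher density is a probability density. -/
lemma normConst_mul_integral_exp (hd : 2 ≤ d) (μ : Sphere d) (κ : ℝ≥0) :
    normConst d κ * ∫ x : Sphere d, Real.exp ((κ : ℝ) * inner ℝ (μ : EuclideanSpace ℝ (Fin d))
        (x : EuclideanSpace ℝ (Fin d))) ∂(surface d) = 1 := by
  have : Nonempty (Fin d) := ⟨⟨0, by omega⟩⟩
  have hne : NeZero (surface d) := ⟨by unfold surface; exact Measure.toSphere_ne_zero _⟩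
  rw [normConst]
  split_ifs with h
  · subst h
    simpa using inv_mul_cancel₀ (measureReal_univ_ne_zero (μ := surface d))
  · have hκ : 0 < (κ : ℝ) := by exact_mod_cast pos_iff_ne_zero.2 h
    have h1 := integral_exp_inner_eq_besselI hd μ hκ
    rw [← h1, div_mul_eq_mul_div, div_self]
    have h2 : 0 < ∫ x : Sphere d, Real.exp ((κ : ℝ) * inner ℝ (μ : EuclideanSpace ℝ (Fin d))
        (x : EuclideanSpace ℝ (Fin d))) ∂(surface d) :=
      integral_exp_pos (integrable_of_continuous_surface (by fun_prop))
    positivity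

end Normalization
-- Continuity and positivity of densities, measure of caps, Gaussian-type bound.
section Density

variable {d p : ℕ}

lemma sphere_inner_eq (μ x : Sphere d) :
    inner ℝ (μ : EuclideanSpace ℝ (Fin d)) (x : EuclideanSpace ℝ (Fin d)) = 1 - dist x μ ^ 2 / 2 := by
  have h := norm_sub_sq_real (x : EuclideanSpace ℝ (Fin d)) (μ : EuclideanSpace ℝ (Fin d))
  rw [Subtype.dist_eq, dist_eq_norm, h, real_inner_comm]
  simp
  ring

/-- One formula for both branches of the definition: it gives continuity at `κ = 0` and makes the
Bessel function unnecessary from here on. -/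
lemma normConst_eq_inv (hd : 2 ≤ d) (μ : Sphere d) (κ : ℝ≥0) :
    normConst d κ = (∫ x : Sphere d, Real.exp ((κ : ℝ) * inner ℝ (μ : EuclideanSpace ℝ (Fin d))
        (x : EuclideanSpace ℝ (Fin d))) ∂(surface d))⁻¹ :=
  eq_inv_of_mul_eq_one_left (normConst_mul_integral_exp hd μ κ)

lemma nonempty_sphere (hd : 2 ≤ d) : Nonempty (Sphere d) := by
  have : Nonempty (Fin d) := ⟨⟨0, by omega⟩⟩
  exact (NormedSpace.sphere_nonempty.2 zero_le_one).to_subtype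

lemma integral_exp_inner_pos (hd : 2 ≤ d) (μ : Sphere d) (κ : ℝ) :
    0 < ∫ x : Sphere d, Real.exp (κ * inner ℝ (μ : EuclideanSpace ℝ (Fin d))
        (x : EuclideanSpace ℝ (Fin d))) ∂(surface d) := by
  have : Nonempty (Fin d) := ⟨⟨0, by omega⟩⟩
  have hne : NeZero (surface d) := ⟨by unfold surface; exact Measure.toSphere_ne_zero _⟩
  exact integral_exp_pos (integrable_of_continuous_surface (by fun_prop))

lemma normConst_pos (hd : 2 ≤ d) (κ : ℝ≥0) : 0 < normConst d κ := by
  obtain ⟨μ⟩ := nonempty_sphere hd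
  rw [normConst_eq_inv hd μ]
  exact inv_pos.2 (integral_exp_inner_pos hd μ κ)

lemma continuous_normConst (hd : 2 ≤ d) : Continuous (normConst d) := by
  obtain ⟨μ⟩ := nonempty_sphere hd
  rw [funext (normConst_eq_inv hd μ)]
  refine Continuous.inv₀ ?_ fun κ => (integral_exp_inner_pos hd μ κ).ne'
  have := continuous_parametric_integral_of_continuous (μ := surface d) (X := ℝ≥0)
    (f := fun κ x => Real.exp ((κ : ℝ) * inner ℝ (μ : EuclideanSpace ℝ (Fin d))
        (x : EuclideanSpace ℝ (Fin d)))) (by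
      simp only [Function.uncurry_def]
      fun_prop) isCompact_univ
  simpa using this

lemma continuous_density (hd : 2 ≤ d) :
    Continuous fun q : Component d × Sphere d => density q.1 q.2 := by
  have := continuous_normConst hd
  unfold density
  fun_prop

lemma density_pos (hd : 2 ≤ d) (θ : Component d) (x : Sphere d) : 0 < density θ x :=
  mul_pos (normConst_pos hd _) (Real.exp_pos _)

lemma integral_density (hd : 2 ≤ d) (θ : Component d) : ∫ x, density θ x ∂(surface d) = 1 := by
  simp only [density]
  rw [integral_const_mul]
  exact normConst_mul_integral_exp hd θ.1 θ.2

lemma continuous_density_right (hd : 2 ≤ d) (θ : Component d) : Continuous (density θ) :=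
  (continuous_density hd).comp (by fun_prop : Continuous fun x => (θ, x))

lemma continuous_mixDensity (hd : 2 ≤ d) (γ : Param d p) : Continuous (mixDensity γ) := by
  unfold mixDensity
  exact continuous_finsetSum _ fun k _ => continuous_const.mul (continuous_density_right hd _)

lemma mixDensity_pos (hd : 2 ≤ d) (γ : Param d p) (x : Sphere d) : 0 < mixDensity γ x := by
  have h1 := γ.1.2.2
  have h0 := γ.1.2.1
  obtain ⟨k, hk⟩ : ∃ k, (γ.1 : Fin p → ℝ) k ≠ 0 := by
    by_contra! h
    exact zero_ne_one ((Finset.sum_eq_zero fun k _ => h k).symm.trans h1)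
  exact Finset.sum_pos' (fun k _ => mul_nonneg (h0 k) (density_pos hd _ _).le)
    ⟨k, Finset.mem_univ _, mul_pos ((h0 k).lt_of_ne' hk) (density_pos hd _ _)⟩

lemma integral_sum_density (hd : 2 ≤ d) {ι : Type*} (s : Finset ι) (w : ι → ℝ)
    (θ : ι → Component d) :
    ∫ x, ∑ k ∈ s, w k * density (θ k) x ∂(surface d) = ∑ k ∈ s, w k := by
  rw [integral_finsetSum _ fun k _ =>
    (integrable_of_continuous_surface (continuous_density_right hd _)).const_mul _]
  simp [integral_const_mul, integral_density hd]

lemma integral_mixDensity (hd : 2 ≤ d) (γ : Param d p) : ∫ x, mixDensity γ x ∂(surface d) = 1 := by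
  unfold mixDensity
  rw [integral_sum_density hd]
  exact γ.1.2.2

/-- Caps of radius `r` have surface measure at least of the order `r ^ d`. -/
lemma exists_le_surface_ball (hd : 2 ≤ d) :
    ∃ c > 0, ∀ (x : Sphere d) (r : ℝ), 0 < r → r ≤ 1 →
      c * r ^ d ≤ (surface d).real (Metric.ball x r) := by
  refine ⟨d * (1 / 4) ^ d * (volume : Measure (EuclideanSpace ℝ (Fin d))).real (Metric.ball 0 1),
    ?_, fun x r hr hr1 => ?_⟩
  · have h1 : 0 < (volume : Measure (EuclideanSpace ℝ (Fin d))).real (Metric.ball 0 1) :=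
      ENNReal.toReal_pos (Metric.measure_ball_pos _ _ one_pos).ne' measure_ball_lt_top.ne
    have : (0 : ℝ) < d := by exact_mod_cast (by omega : 0 < d)
    positivity
  · refine le_trans (le_of_eq ?_)
      (Measure.toSphereBallBound_mul_measureReal_unitBall_le_toSphere_ball volume hr x)
    have h0 : d ≠ 0 := by omega
    have h2 : min r.toNNReal 2 = r.toNNReal := by
      refine min_eq_left ?_
      rw [Real.toNNReal_le_iff_le_coe]
      exact hr1.trans (by norm_num)
    simp only [Measure.toSphereBallBound, finrank_euclideanSpace, Fintype.card_fin]
    rw [if_pos ⟨h0, hr⟩, h2]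
    push_cast
    rw [Real.coe_toNNReal _ hr.le, div_pow, div_pow]
    ring

open scoped Pointwise in
/-- Caps of radius `r` have surface measure at most of the order `r`. -/
lemma exists_surface_closedBall_le (hd : 2 ≤ d) :
    ∃ C > 0, ∀ (x : Sphere d) (r : ℝ), 0 < r →
      (surface d).real (Metric.closedBall x r) ≤ C * r := by
  set V := (volume : Measure (EuclideanSpace ℝ (Fin d))).real (Metric.ball 0 1) with hV
  have hV0 : 0 < V :=
      ENNReal.toReal_pos (Metric.measure_ball_pos _ _ one_pos).ne' measure_ball_lt_top.ne
  have hd0 : (0 : ℝ) < d := by exact_mod_cast (by omega : 0 < d)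
  refine ⟨d * (3 * 2 ^ d * V) + (surface d).real Set.univ, by positivity, fun x r hr => ?_⟩
  rcases le_or_gt 1 r with h1 | h1
  · calc (surface d).real (Metric.closedBall x r) ≤ (surface d).real Set.univ :=
          measureReal_mono (Set.subset_univ _)
      _ ≤ (surface d).real Set.univ * r := le_mul_of_one_le_right measureReal_nonneg h1
      _ ≤ _ := by
        have : 0 ≤ d * (3 * 2 ^ d * V) * r := by positivity
        linarith
  · set N := ⌈1 / r⌉₊ with hN
    have hN1 : 1 / r ≤ N := Nat.le_ceil _
    have hN2 : (N : ℝ) < 1 / r + 1 := Nat.ceil_lt_add_one (by positivity)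
    have hN0 : (0 : ℝ) < N := lt_of_lt_of_le (by positivity) hN1
    have hNr : 1 / (N : ℝ) ≤ r := by rwa [one_div_le hN0 hr]
    -- The surface measure of the cap is `d` times the volume of the cone over it. About `1 / r`
    -- balls of radius `2 r`, centred on the axis, cover the cone; the volume is thus of order `r ^
    -- (d - 1)`, which is at most `r` since `d ≥ 2`.
    have hsub : Set.Ioo (0 : ℝ) 1 • ((↑) '' (Metric.closedBall x r) :
        Set (EuclideanSpace ℝ (Fin d))) ⊆ ⋃ k ∈ Finset.range (N + 1),
          Metric.closedBall (((k : ℝ) / N) • (x : EuclideanSpace ℝ (Fin d))) (2 * r) := by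
      rintro _ ⟨s, hs, _, ⟨z, hz, rfl⟩, rfl⟩
      have hs0 : 0 ≤ s * N := mul_nonneg hs.1.le hN0.le
      have hfl : (⌊s * N⌋₊ : ℝ) ≤ s * N := Nat.floor_le hs0
      have hfl' : s * N < ⌊s * N⌋₊ + 1 := Nat.lt_floor_add_one _
      simp only [Set.mem_iUnion, Finset.mem_range]
      refine ⟨⌊s * N⌋₊, ?_, ?_⟩
      · rw [Nat.lt_succ_iff]
        exact_mod_cast hfl.trans (mul_le_of_le_one_left hN0.le hs.2.le)
      · rw [mem_closedBall_iff_norm]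
        have e1 : s • (z : EuclideanSpace ℝ (Fin d)) - ((⌊s * N⌋₊ : ℝ) / N) • (x : EuclideanSpace ℝ (Fin d))
            = s • ((z : EuclideanSpace ℝ (Fin d)) - x) +
              (s - (⌊s * N⌋₊ : ℝ) / N) • (x : EuclideanSpace ℝ (Fin d)) := by
          module
        have hz' : ‖(z : EuclideanSpace ℝ (Fin d)) - x‖ ≤ r := by
          rwa [← dist_eq_norm, ← Subtype.dist_eq]
        have hx : ‖(x : EuclideanSpace ℝ (Fin d))‖ = 1 := by simp
        have h5 : |s - (⌊s * N⌋₊ : ℝ) / N| ≤ r := by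
          refine le_trans ?_ hNr
          rw [abs_of_nonneg (by rw [sub_nonneg, div_le_iff₀ hN0]; exact hfl),
            le_div_iff₀ hN0, sub_mul, div_mul_cancel₀ _ hN0.ne']
          linarith
        calc _ ≤ ‖s • ((z : EuclideanSpace ℝ (Fin d)) - x)‖ +
              ‖(s - (⌊s * N⌋₊ : ℝ) / N) • (x : EuclideanSpace ℝ (Fin d))‖ := by
                rw [e1]; exact norm_add_le _ _
          _ ≤ r + r := by
            rw [norm_smul, norm_smul, hx, mul_one, Real.norm_eq_abs, Real.norm_eq_abs,
              abs_of_pos hs.1]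
            exact add_le_add ((mul_le_of_le_one_left (norm_nonneg _) hs.2.le).trans hz') h5
          _ = 2 * r := by ring
    have hball : ∀ y : EuclideanSpace ℝ (Fin d),
        (volume : Measure (EuclideanSpace ℝ (Fin d))).real (Metric.closedBall y (2 * r)) =
          (2 * r) ^ d * V := by
      intro y
      rw [measureReal_def, Measure.addHaar_closedBall _ _ (by positivity), ENNReal.toReal_mul,
        ENNReal.toReal_ofReal (by positivity)]
      simp [hV, measureReal_def]
    have hmain : (volume : Measure (EuclideanSpace ℝ (Fin d))).real
        (Set.Ioo (0 : ℝ) 1 • ((↑) '' (Metric.closedBall x r) : Set (EuclideanSpace ℝ (Fin d))))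
        ≤ 3 * 2 ^ d * V * r := by
      calc _ ≤ (volume : Measure (EuclideanSpace ℝ (Fin d))).real
            (⋃ k ∈ Finset.range (N + 1),
              Metric.closedBall (((k : ℝ) / N) • (x : EuclideanSpace ℝ (Fin d))) (2 * r)) := by
            refine measureReal_mono hsub ?_
            refine ((measure_biUnion_finset_le _ _).trans_lt ?_).ne
            exact ENNReal.sum_lt_top.2 fun k _ => measure_closedBall_lt_top
        _ ≤ ∑ k ∈ Finset.range (N + 1), (volume : Measure (EuclideanSpace ℝ (Fin d))).real
              (Metric.closedBall (((k : ℝ) / N) • (x : EuclideanSpace ℝ (Fin d))) (2 * r)) :=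
            measureReal_biUnion_finset_le _ _
        _ = (N + 1) * ((2 * r) ^ d * V) := by simp [hball]
        _ ≤ (3 / r) * ((2 * r) ^ d * V) := by
            gcongr
            rw [le_div_iff₀ hr]
            have : (N : ℝ) * r < (1 / r + 1) * r := by gcongr
            have e : (1 / r + 1) * r = 1 + r := by field_simp
            nlinarith
        _ = 3 * 2 ^ d * V * (r ^ (d - 1)) := by
            obtain ⟨e, rfl⟩ : ∃ e, d = e + 1 := ⟨d - 1, by omega⟩
            rw [mul_pow, pow_succ r]
            field_simp
            simp
        _ ≤ 3 * 2 ^ d * V * r := by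
            gcongr
            exact pow_le_of_le_one hr.le h1.le (by omega)
    have hs : (surface d).real (Metric.closedBall x r) = d * (volume : Measure (EuclideanSpace ℝ (Fin d))).real
        (Set.Ioo (0 : ℝ) 1 • ((↑) '' (Metric.closedBall x r) : Set (EuclideanSpace ℝ (Fin d)))) := by
      rw [measureReal_def, surface, Measure.toSphere_apply' _ Metric.isClosed_closedBall.measurableSet]
      simp [measureReal_def]
    rw [hs]
    have : 0 ≤ (surface d).real Set.univ * r := mul_nonneg measureReal_nonneg hr.le
    have h6 := mul_le_mul_of_nonneg_left hmain hd0.le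
    linarith

/-- A polynomially growing, Gaussian-like upper bound of the density. -/
lemma exists_density_le (hd : 2 ≤ d) :
    ∃ C > 0, ∀ (θ : Component d), 1 ≤ θ.2 → ∀ x : Sphere d,
      density θ x ≤ C * (θ.2 : ℝ) ^ d * Real.exp (-((θ.2 : ℝ) * dist x θ.1 ^ 2 / 2)) := by
  obtain ⟨c, hc, hball⟩ := exists_le_surface_ball hd
  refine ⟨Real.exp (1 / 2) / c, by positivity, fun θ hκ x => ?_⟩
  obtain ⟨μ, κ⟩ := θ
  simp only at hκ ⊢
  have hκ1 : (1 : ℝ) ≤ κ := by exact_mod_cast hκ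
  have hκ0 : (0 : ℝ) < κ := by linarith
  have hr1 : 1 / (κ : ℝ) ≤ 1 := by rw [div_le_one hκ0]; exact hκ1
  -- Only the cap of radius `1 / κ` is kept: there `κ * dist ^ 2 / 2 ≤ 1 / 2`, and its measure is at
  -- least `c / κ ^ d`.
  have hJ : c * (1 / (κ : ℝ)) ^ d * Real.exp (κ - 1 / 2) ≤ ∫ x : Sphere d, Real.exp ((κ : ℝ) *
      inner ℝ (μ : EuclideanSpace ℝ (Fin d)) (x : EuclideanSpace ℝ (Fin d))) ∂(surface d) := by
    have hint : Integrable (fun x : Sphere d => Real.exp ((κ : ℝ) *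
      inner ℝ (μ : EuclideanSpace ℝ (Fin d)) (x : EuclideanSpace ℝ (Fin d)))) (surface d) :=
      integrable_of_continuous_surface (by fun_prop)
    calc c * (1 / (κ : ℝ)) ^ d * Real.exp (κ - 1 / 2)
        ≤ (surface d).real (Metric.ball μ (1 / κ)) * Real.exp (κ - 1 / 2) := by
          gcongr
          exact hball μ _ (by positivity) hr1
      _ = ∫ _ in Metric.ball μ (1 / (κ : ℝ)), Real.exp (κ - 1 / 2) ∂(surface d) := by simp
      _ ≤ ∫ x in Metric.ball μ (1 / (κ : ℝ)), Real.exp ((κ : ℝ) *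
            inner ℝ (μ : EuclideanSpace ℝ (Fin d)) (x : EuclideanSpace ℝ (Fin d))) ∂(surface d) := by
          refine setIntegral_mono_on (integrable_const _) hint.integrableOn
            Metric.isOpen_ball.measurableSet fun y hy => ?_
          rw [Real.exp_le_exp, sphere_inner_eq]
          have hy1 : dist y μ < 1 / κ := hy
          have hy2 : dist y μ * κ ≤ 1 := by rw [lt_div_iff₀ hκ0] at hy1; exact hy1.le
          have hy3 : dist y μ ≤ 1 := hy1.le.trans hr1
          have h0 := dist_nonneg (x := y) (y := μ)
          nlinarith
      _ ≤ _ := setIntegral_le_integral hint (.of_forall fun y => (Real.exp_pos _).le)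
  have hN : normConst d κ ≤ (c * (1 / (κ : ℝ)) ^ d * Real.exp (κ - 1 / 2))⁻¹ := by
    rw [normConst_eq_inv hd μ]
    exact inv_anti₀ (by positivity) hJ
  rw [density]
  refine (mul_le_mul_of_nonneg_right hN (Real.exp_pos _).le).trans (le_of_eq ?_)
  simp only
  rw [sphere_inner_eq, show (κ : ℝ) * (1 - dist x μ ^ 2 / 2) = (κ - 1 / 2) + 1 / 2 + -(κ * dist x μ ^ 2 / 2) by ring,
    Real.exp_add, Real.exp_add, one_div (κ : ℝ), inv_pow]
  field_simp

end Density
-- Second-moment bound for the number of close pairs.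
section ClosePairs

variable {Ω S : Type*} [MeasurableSpace Ω] {P : Measure Ω} [IsProbabilityMeasure P]
  [MetricSpace S] [SecondCountableTopology S] [MeasurableSpace S] [BorelSpace S]
  {X : ℕ → Ω → S} {ν : Measure S} {C ρ : ℝ}

/-- The indicator of being at distance at most `ρ`. -/
noncomputable def closeInd (ρ : ℝ) (q : S × S) : ℝ :=
  Set.indicator {q : S × S | dist q.1 q.2 ≤ ρ} 1 q

omit [MeasurableSpace S] [BorelSpace S] [SecondCountableTopology S] in
lemma closeInd_eq (ρ : ℝ) (q : S × S) : closeInd ρ q = 0 ∨ closeInd ρ q = 1 := by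
  unfold closeInd
  by_cases h : q ∈ {q : S × S | dist q.1 q.2 ≤ ρ} <;> simp [h]

lemma measurableSet_dist_le (ρ : ℝ) : MeasurableSet {q : S × S | dist q.1 q.2 ≤ ρ} :=
  measurableSet_le measurable_dist measurable_const

lemma measurable_closeInd (ρ : ℝ) : Measurable (closeInd ρ : S × S → ℝ) :=
  measurable_one.indicator (measurableSet_dist_le ρ)

/-- The probability that two independent points are at distance at most `ρ`. -/
noncomputable def closeProb (ν : Measure S) (ρ : ℝ) : ℝ :=
  (ν.prod ν).real {q : S × S | dist q.1 q.2 ≤ ρ}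

lemma closeProb_le [IsProbabilityMeasure ν] (hC : 0 ≤ C) (hρ : 0 < ρ)
    (hν : ∀ (x : S) (r : ℝ), 0 < r → ν.real (Metric.closedBall x r) ≤ C * r) :
    closeProb ν ρ ≤ C * ρ := by
  rw [closeProb, measureReal_def, Measure.prod_apply (measurableSet_dist_le ρ)]
  refine ENNReal.toReal_le_of_le_ofReal (by positivity) ?_
  calc ∫⁻ x, ν (Prod.mk x ⁻¹' {q : S × S | dist q.1 q.2 ≤ ρ}) ∂ν
      ≤ ∫⁻ _, ENNReal.ofReal (C * ρ) ∂ν := by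
        refine lintegral_mono fun x => ?_
        rw [← ENNReal.ofReal_toReal (measure_ne_top ν _)]
        refine ENNReal.ofReal_le_ofReal (le_trans (le_of_eq ?_) (hν x ρ hρ))
        rw [measureReal_def]
        congr 2
        ext y
        simp [dist_comm]
    _ = ENNReal.ofReal (C * ρ) := by simp

omit [MetricSpace S] [SecondCountableTopology S] [BorelSpace S] in
lemma map_pair_eq [IsProbabilityMeasure ν] (hX : ∀ i, Measurable (X i)) (hindep : iIndepFun X P)
    (hlaw : ∀ i, P.map (X i) = ν) {i j : ℕ} (hij : i ≠ j) :
    P.map (fun ω => (X i ω, X j ω)) = ν.prod ν := by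
  rw [(indepFun_iff_map_prod_eq_prod_map_map (hX i).aemeasurable (hX j).aemeasurable).1
    (hindep.indepFun hij), hlaw, hlaw]

/-- The centered indicator that the points `X i` and `X j` are close. -/
noncomputable def closeDev (X : ℕ → Ω → S) (ν : Measure S) (ρ : ℝ) (p : ℕ × ℕ) (ω : Ω) : ℝ :=
  closeInd ρ (X p.1 ω, X p.2 ω) - closeProb ν ρ

lemma measurable_closeDev (hX : ∀ i, Measurable (X i)) (p : ℕ × ℕ) :
    Measurable (closeDev X ν ρ p) :=
  ((measurable_closeInd ρ).comp ((hX _).prodMk (hX _))).sub_const _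

omit [MeasurableSpace Ω] [SecondCountableTopology S] [BorelSpace S] in
lemma abs_closeDev_le [IsProbabilityMeasure ν] (p : ℕ × ℕ) (ω : Ω) :
    |closeDev X ν ρ p ω| ≤ 1 := by
  have h0 : 0 ≤ closeProb ν ρ := measureReal_nonneg
  have h1 : closeProb ν ρ ≤ 1 := measureReal_le_one
  rcases closeInd_eq ρ (X p.1 ω, X p.2 ω) with h | h <;>
  · rw [closeDev, h, abs_le]
    constructor <;> linarith

lemma integrable_closeDev_mul [IsProbabilityMeasure ν] (hX : ∀ i, Measurable (X i)) (p r : ℕ × ℕ) :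
    Integrable (fun ω => closeDev X ν ρ p ω * closeDev X ν ρ r ω) P := by
  refine Integrable.of_bound
    ((measurable_closeDev hX p).mul (measurable_closeDev hX r)).aestronglyMeasurable 1
    (.of_forall fun ω => ?_)
  rw [norm_mul, Real.norm_eq_abs, Real.norm_eq_abs]
  exact mul_le_one₀ (abs_closeDev_le p ω) (abs_nonneg _) (abs_closeDev_le r ω)

lemma integral_closeInd [IsProbabilityMeasure ν] (hX : ∀ i, Measurable (X i))
    (hindep : iIndepFun X P) (hlaw : ∀ i, P.map (X i) = ν) {p : ℕ × ℕ} (hp : p.1 ≠ p.2) :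
    ∫ ω, closeInd ρ (X p.1 ω, X p.2 ω) ∂P = closeProb ν ρ := by
  have h := integral_map (μ := P) (φ := fun ω => (X p.1 ω, X p.2 ω))
    ((hX p.1).prodMk (hX p.2)).aemeasurable (f := closeInd ρ)
    (measurable_closeInd ρ).aestronglyMeasurable
  rw [← h, map_pair_eq hX hindep hlaw hp]
  exact integral_indicator_one (measurableSet_dist_le ρ)

lemma integrable_closeInd (hX : ∀ i, Measurable (X i)) (p : ℕ × ℕ) :
    Integrable (fun ω => closeInd ρ (X p.1 ω, X p.2 ω)) P := by
  refine Integrable.of_bound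
    ((measurable_closeInd ρ).comp ((hX _).prodMk (hX _))).aestronglyMeasurable 1
    (.of_forall fun ω => ?_)
  rcases closeInd_eq ρ (X p.1 ω, X p.2 ω) with h | h <;> simp [h]

lemma integral_closeDev [IsProbabilityMeasure ν] (hX : ∀ i, Measurable (X i))
    (hindep : iIndepFun X P) (hlaw : ∀ i, P.map (X i) = ν) {p : ℕ × ℕ} (hp : p.1 ≠ p.2) :
    ∫ ω, closeDev X ν ρ p ω ∂P = 0 := by
  unfold closeDev
  rw [integral_sub (integrable_closeInd hX p) (integrable_const _),
    integral_closeInd hX hindep hlaw hp]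
  simp

lemma integral_closeDev_sq_le [IsProbabilityMeasure ν] (hX : ∀ i, Measurable (X i))
    (hindep : iIndepFun X P) (hlaw : ∀ i, P.map (X i) = ν) {p : ℕ × ℕ} (hp : p.1 ≠ p.2) :
    ∫ ω, closeDev X ν ρ p ω * closeDev X ν ρ p ω ∂P ≤ closeProb ν ρ := by
  have h0 : 0 ≤ closeProb ν ρ := measureReal_nonneg
  have e : ∀ ω, closeDev X ν ρ p ω * closeDev X ν ρ p ω =
      (1 - 2 * closeProb ν ρ) * closeInd ρ (X p.1 ω, X p.2 ω) + closeProb ν ρ ^ 2 := by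
    intro ω
    rcases closeInd_eq ρ (X p.1 ω, X p.2 ω) with h | h <;> rw [closeDev, h] <;> ring
  simp_rw [e]
  rw [integral_add ((integrable_closeInd hX p).const_mul _) (integrable_const _), integral_const_mul,
    integral_closeInd hX hindep hlaw hp]
  simp
  nlinarith

/-- Index pairs without a common index are independent, hence uncorrelated; the others are handled
by `2ab ≤ a² + b²` and the variance bound. The indicators count coincidences in a form that is easy
to sum over `r`. -/
lemma integral_closeDev_mul_le [IsProbabilityMeasure ν] (hX : ∀ i, Measurable (X i))
    (hindep : iIndepFun X P) (hlaw : ∀ i, P.map (X i) = ν) {p r : ℕ × ℕ}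
    (hp : p.1 ≠ p.2) (hr : r.1 ≠ r.2) :
    ∫ ω, closeDev X ν ρ p ω * closeDev X ν ρ r ω ∂P ≤
      closeProb ν ρ * ((if r.1 = p.1 then 1 else 0) + (if r.1 = p.2 then 1 else 0) +
        (if r.2 = p.1 then 1 else 0) + (if r.2 = p.2 then 1 else 0)) := by
  have h0 : 0 ≤ closeProb ν ρ := measureReal_nonneg
  by_cases hdis : r.1 = p.1 ∨ r.1 = p.2 ∨ r.2 = p.1 ∨ r.2 = p.2
  · have h1 : (1 : ℝ) ≤ (if r.1 = p.1 then 1 else 0) + (if r.1 = p.2 then 1 else 0) +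
        (if r.2 = p.1 then 1 else 0) + (if r.2 = p.2 then 1 else 0) := by
      rcases hdis with h | h | h | h <;> rw [if_pos h] <;> split_ifs <;> norm_num
    refine le_trans ?_ (le_mul_of_one_le_right h0 h1)
    have hpp := integral_closeDev_sq_le (ρ := ρ) hX hindep hlaw hp
    have hrr := integral_closeDev_sq_le (ρ := ρ) hX hindep hlaw hr
    calc ∫ ω, closeDev X ν ρ p ω * closeDev X ν ρ r ω ∂P
        ≤ ∫ ω, (1 / 2 * (closeDev X ν ρ p ω * closeDev X ν ρ p ω) +
            1 / 2 * (closeDev X ν ρ r ω * closeDev X ν ρ r ω)) ∂P := by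
          refine integral_mono (integrable_closeDev_mul hX p r)
            (((integrable_closeDev_mul hX p p).const_mul _).add
              ((integrable_closeDev_mul hX r r).const_mul _)) fun ω => ?_
          simp only []
          nlinarith [sq_nonneg (closeDev X ν ρ p ω - closeDev X ν ρ r ω)]
      _ ≤ closeProb ν ρ := by
          rw [integral_add ((integrable_closeDev_mul hX p p).const_mul _)
              ((integrable_closeDev_mul hX r r).const_mul _), integral_const_mul, integral_const_mul]
          linarith
  · push Not at hdis
    obtain ⟨h1, h2, h3, h4⟩ := hdis
    have hind := hindep.indepFun_prodMk_prodMk hX p.1 p.2 r.1 r.2 h1.symm h3.symm h2.symm h4.symm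
    have hm : Measurable fun q : S × S => closeInd ρ q - closeProb ν ρ :=
      (measurable_closeInd ρ).sub_const _
    have h5 : ∫ ω, closeDev X ν ρ p ω * closeDev X ν ρ r ω ∂P =
        (∫ ω, closeDev X ν ρ p ω ∂P) * ∫ ω, closeDev X ν ρ r ω ∂P :=
      (hind.comp hm hm).integral_fun_mul_eq_mul_integral
        (measurable_closeDev hX p).aestronglyMeasurable
        (measurable_closeDev hX r).aestronglyMeasurable
    rw [h5, integral_closeDev hX hindep hlaw hp]
    simp [h1, h2, h3, h4]

/-- Each of at most `n ^ 2` pairs shares an index with at most `4 n` others, so the variance is of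
order `n ^ 3` rather than `n ^ 4`. -/
lemma integral_sum_closeDev_sq_le [IsProbabilityMeasure ν] (hX : ∀ i, Measurable (X i))
    (hindep : iIndepFun X P) (hlaw : ∀ i, P.map (X i) = ν) (n : ℕ) :
    ∫ ω, (∑ p ∈ (Finset.range n).offDiag, closeDev X ν ρ p ω) ^ 2 ∂P ≤
      4 * n ^ 3 * closeProb ν ρ := by
  have h0 : 0 ≤ closeProb ν ρ := measureReal_nonneg
  simp_rw [sq, Finset.sum_mul_sum]
  rw [integral_finsetSum _ fun p _ => integrable_finsetSum _ fun r _ => integrable_closeDev_mul hX p r]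
  have hcount : ∀ p : ℕ × ℕ, ∑ r ∈ (Finset.range n).offDiag,
      ((if r.1 = p.1 then 1 else 0) + (if r.1 = p.2 then 1 else 0) +
        (if r.2 = p.1 then 1 else 0) + (if r.2 = p.2 then 1 else 0) : ℝ) ≤ 4 * n := by
    intro p
    have hle : ∀ a : ℕ, (∑ i ∈ Finset.range n, if i = a then (1 : ℝ) else 0) ≤ 1 := by
      intro a
      rw [Finset.sum_ite_eq']
      split_ifs <;> norm_num
    calc _ ≤ ∑ r ∈ Finset.range n ×ˢ Finset.range n,
          ((if r.1 = p.1 then 1 else 0) + (if r.1 = p.2 then 1 else 0) +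
          (if r.2 = p.1 then 1 else 0) + (if r.2 = p.2 then 1 else 0) : ℝ) := by
          refine Finset.sum_le_sum_of_subset_of_nonneg ?_ fun r _ _ => ?_
          · intro r hr
            rw [Finset.mem_offDiag] at hr
            exact Finset.mem_product.2 ⟨hr.1, hr.2.1⟩
          · split_ifs <;> norm_num
      _ ≤ 4 * n := by
          rw [Finset.sum_product]
          have hn : ∀ a : ℕ, (∑ i ∈ Finset.range n, ∑ _j ∈ Finset.range n,
              if i = a then (1 : ℝ) else 0) ≤ n := fun a => by
            rw [Finset.sum_comm]
            simpa using Finset.sum_le_card_nsmul (Finset.range n) _ 1 fun _ _ => hle a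
          have hn' : ∀ a : ℕ, (∑ _i ∈ Finset.range n, ∑ j ∈ Finset.range n,
              if j = a then (1 : ℝ) else 0) ≤ n := fun a => by
            simpa using Finset.sum_le_card_nsmul (Finset.range n) _ 1 fun _ _ => hle a
          simp only [Finset.sum_add_distrib]
          linarith [hn p.1, hn p.2, hn' p.1, hn' p.2]
  have hcard : (((Finset.range n).offDiag.card : ℕ) : ℝ) ≤ n ^ 2 := by
    rw [Finset.offDiag_card, Finset.card_range]
    exact_mod_cast (Nat.sub_le _ _).trans (by rw [sq])
  calc _ ≤ ∑ p ∈ (Finset.range n).offDiag, closeProb ν ρ * (4 * n) := by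
        refine Finset.sum_le_sum fun p hp => ?_
        rw [integral_finsetSum _ fun r _ => integrable_closeDev_mul hX p r]
        refine le_trans (Finset.sum_le_sum fun r hr =>
          integral_closeDev_mul_le hX hindep hlaw (Finset.mem_offDiag.1 hp).2.2
            (Finset.mem_offDiag.1 hr).2.2) ?_
        rw [← Finset.mul_sum]
        exact mul_le_mul_of_nonneg_left (hcount p) h0
    _ ≤ 4 * n ^ 3 * closeProb ν ρ := by
        rw [Finset.sum_const, nsmul_eq_mul]
        calc _ ≤ (n : ℝ) ^ 2 * (closeProb ν ρ * (4 * n)) := by gcongr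
          _ = _ := by ring

/-- The number of ordered pairs of close points is concentrated around its mean. -/
lemma mul_measure_closePairs_le [IsProbabilityMeasure ν] (hX : ∀ i, Measurable (X i))
    (hindep : iIndepFun X P) (hlaw : ∀ i, P.map (X i) = ν) {n : ℕ} (hn : 0 < n) {τ : ℝ}
    (hτ : 0 < τ) :
    P.real {ω | n ^ 2 * (closeProb ν ρ + τ) ≤
      ∑ p ∈ (Finset.range n).offDiag, closeInd ρ (X p.1 ω, X p.2 ω)} ≤
      4 * closeProb ν ρ / (n * τ ^ 2) := by
  have hn' : (0 : ℝ) < n := by exact_mod_cast hn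
  have h0 : 0 ≤ closeProb ν ρ := measureReal_nonneg
  have hcard : (((Finset.range n).offDiag.card : ℕ) : ℝ) ≤ n ^ 2 := by
    rw [Finset.offDiag_card, Finset.card_range]
    exact_mod_cast (Nat.sub_le _ _).trans (by rw [sq])
  have hint : Integrable (fun ω => (∑ p ∈ (Finset.range n).offDiag, closeDev X ν ρ p ω) ^ 2) P := by
    simp_rw [sq, Finset.sum_mul_sum]
    exact integrable_finsetSum _ fun p _ => integrable_finsetSum _ fun r _ =>
      integrable_closeDev_mul hX p r
  -- Chebyshev's inequality at deviation `n ^ 2 * τ`.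
  have hmk := mul_meas_ge_le_integral_of_nonneg (.of_forall fun ω => sq_nonneg _) hint
    (((n : ℝ) ^ 2 * τ) ^ 2)
  have hsub : {ω | n ^ 2 * (closeProb ν ρ + τ) ≤
      ∑ p ∈ (Finset.range n).offDiag, closeInd ρ (X p.1 ω, X p.2 ω)} ⊆
      {ω | ((n : ℝ) ^ 2 * τ) ^ 2 ≤ (∑ p ∈ (Finset.range n).offDiag, closeDev X ν ρ p ω) ^ 2} := by
    intro ω hω
    simp only [Set.mem_ofPred_eq] at hω ⊢
    have e : ∑ p ∈ (Finset.range n).offDiag, closeDev X ν ρ p ω =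
        ∑ p ∈ (Finset.range n).offDiag, closeInd ρ (X p.1 ω, X p.2 ω) -
          (Finset.range n).offDiag.card * closeProb ν ρ := by
      simp [closeDev, Finset.sum_sub_distrib]
    refine pow_le_pow_left₀ (by positivity) ?_ 2
    rw [e]
    have := mul_le_mul_of_nonneg_right hcard h0
    linarith
  rw [le_div_iff₀ (by positivity)]
  have h1 := (mul_le_mul_of_nonneg_left (measureReal_mono (μ := P) hsub)
    (sq_nonneg ((n : ℝ) ^ 2 * τ))).trans (hmk.trans (integral_sum_closeDev_sq_le hX hindep hlaw n))
  have h3 : (0 : ℝ) < n ^ 3 := by positivity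
  refine le_of_mul_le_mul_left ?_ h3
  calc _ = ((n : ℝ) ^ 2 * τ) ^ 2 * P.real _ := by ring
    _ ≤ _ := h1
    _ = _ := by ring

end ClosePairs
-- Uniform bounds on the number of observations in small balls.
section Count

variable {Ω S : Type*} [MeasurableSpace Ω] {P : Measure Ω} [IsProbabilityMeasure P]
  [MetricSpace S] [SecondCountableTopology S] [MeasurableSpace S] [BorelSpace S]
  {X : ℕ → Ω → S} {ν : Measure S} {C : ℝ}

/-- Along the dyadic sample sizes, almost surely there are few close pairs at all scales. -/
lemma ae_closePairs_le [IsProbabilityMeasure ν] (hX : ∀ i, Measurable (X i))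
    (hindep : iIndepFun X P) (hlaw : ∀ i, P.map (X i) = ν) (hC : 0 ≤ C)
    (hν : ∀ (x : S) (r : ℝ), 0 < r → ν.real (Metric.closedBall x r) ≤ C * r) :
    ∀ᵐ ω ∂P, ∃ k₀ : ℕ, ∀ k ≥ k₀, ∀ j : ℕ,
      ∑ p ∈ (Finset.range (2 ^ k)).offDiag, closeInd ((1 / 256) ^ j) (X p.1 ω, X p.2 ω) ≤
        (2 ^ k) ^ 2 * ((C + 1) * (1 / 4) ^ j) := by
  -- Since `256 = 16 * 4 ^ 2`, Chebyshev with `τ = 4⁻ʲ` leaves a factor `16⁻ʲ` besides `2⁻ᵏ`. The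
  -- bounds are summable over sample sizes and scales jointly, so one Borel-Cantelli argument covers
  -- all scales.
  set A : ℕ × ℕ → Set Ω := fun kj => {ω | ((2 ^ kj.1 : ℕ) : ℝ) ^ 2 *
      (closeProb ν ((1 / 256) ^ kj.2) + (1 / 4) ^ kj.2) ≤
      ∑ p ∈ (Finset.range (2 ^ kj.1)).offDiag,
        closeInd ((1 / 256) ^ kj.2) (X p.1 ω, X p.2 ω)} with hA
  have hq : ∀ j : ℕ, closeProb ν ((1 / 256) ^ j) ≤ C * (1 / 256) ^ j :=
    fun j => closeProb_le hC (by positivity) hν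
  have hPA : ∀ kj, P.real (A kj) ≤ 4 * C * ((1 / 2) ^ kj.1 * (1 / 16) ^ kj.2) := by
    intro kj
    refine (mul_measure_closePairs_le hX hindep hlaw (by positivity)
      (by positivity : (0 : ℝ) < (1 / 4) ^ kj.2)).trans ?_
    rw [div_le_iff₀ (by positivity)]
    calc 4 * closeProb ν ((1 / 256) ^ kj.2) ≤ 4 * (C * (1 / 256) ^ kj.2) := by
          gcongr
          exact hq _
      _ = _ := by
          have e1 : (1 / 256 : ℝ) ^ kj.2 = (1 / 16) ^ kj.2 * ((1 / 4) ^ kj.2) ^ 2 := by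
            rw [← pow_mul, mul_comm kj.2, pow_mul, ← mul_pow]; norm_num
          have e2 : (1 / 2 : ℝ) ^ kj.1 * 2 ^ kj.1 = 1 := by rw [← mul_pow]; norm_num
          rw [e1]
          push_cast
          linear_combination (-(4 * C * (1 / 16) ^ kj.2 * ((1 / 4) ^ kj.2) ^ 2)) * e2
  have hsum : Summable fun kj : ℕ × ℕ => 4 * C * ((1 / 2 : ℝ) ^ kj.1 * (1 / 16) ^ kj.2) :=
    (Summable.mul_of_nonneg (summable_geometric_of_lt_one (by norm_num) (by norm_num))
      (summable_geometric_of_lt_one (by norm_num) (by norm_num)) (fun _ => by positivity)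
      (fun _ => by positivity)).mul_left _
  have htop : ∑' kj, P (A kj) ≠ ∞ := by
    refine ne_top_of_le_ne_top hsum.tsum_ofReal_ne_top (ENNReal.tsum_le_tsum fun kj => ?_)
    rw [← ENNReal.ofReal_toReal (measure_ne_top P (A kj))]
    exact ENNReal.ofReal_le_ofReal (hPA kj)
  filter_upwards [ae_finite_setOfPred_mem htop] with ω hω
  obtain ⟨k₁, hk₁⟩ := (hω.image Prod.fst).bddAbove
  refine ⟨k₁ + 1, fun k hk j => ?_⟩
  have hn : (k, j) ∉ {kj | ω ∈ A kj} := fun h => by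
    have := hk₁ ⟨(k, j), h, rfl⟩
    simp only at this
    omega
  simp only [hA, Set.mem_ofPred_eq, not_le] at hn
  refine hn.le.trans ?_
  push_cast
  have h4 : (1 / 256 : ℝ) ^ j ≤ (1 / 4) ^ j := pow_le_pow_left₀ (by norm_num) (by norm_num) j
  have := hq j
  gcongr
  nlinarith

/-- Almost surely, uniformly over all small balls, a ball contains few of the first `n` points. -/
lemma ae_card_ball_le [IsProbabilityMeasure ν] (hX : ∀ i, Measurable (X i))
    (hindep : iIndepFun X P) (hlaw : ∀ i, P.map (X i) = ν) (hC : 0 ≤ C)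
    (hν : ∀ (x : S) (r : ℝ), 0 < r → ν.real (Metric.closedBall x r) ≤ C * r) :
    ∀ᵐ ω ∂P, ∀ᶠ n : ℕ in atTop, ∀ (j : ℕ) (y : S),
      (((Finset.range n).filter fun i => dist (X i ω) y ≤ (1 / 256) ^ j / 2).card : ℝ) ≤
        1 + 2 * (C + 1) * n * (1 / 2) ^ j := by
  filter_upwards [ae_closePairs_le hX hindep hlaw hC hν] with ω ⟨k₀, hk₀⟩
  filter_upwards [eventually_ge_atTop (2 ^ k₀)] with n hn j y
  have hn0 : n ≠ 0 := by
    have : 0 < 2 ^ k₀ := by positivity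
    omega
  -- The number of close pairs increases with the sample size, so it can be bounded at the next
  -- power of two, which is at most `2 n`.
  set k := Nat.log 2 n + 1 with hk
  have hk1 : n < 2 ^ k := Nat.lt_pow_succ_log_self (by norm_num) n
  have hk2 : 2 ^ k ≤ 2 * n := by
    rw [hk, pow_succ, mul_comm]
    exact Nat.mul_le_mul_left 2 (Nat.pow_log_le_self 2 hn0)
  have hk3 : k₀ ≤ k := (Nat.le_log_of_pow_le (by norm_num) hn).trans (Nat.le_succ _)
  set T := (Finset.range n).filter fun i => dist (X i ω) y ≤ (1 / 256) ^ j / 2 with hT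
  have h1 : ((T.offDiag.card : ℕ) : ℝ) ≤
      ∑ p ∈ (Finset.range (2 ^ k)).offDiag, closeInd ((1 / 256) ^ j) (X p.1 ω, X p.2 ω) := by
    have hsub : T.offDiag ⊆ (Finset.range (2 ^ k)).offDiag := by
      refine Finset.offDiag_mono fun i hi => ?_
      rw [hT, Finset.mem_filter, Finset.mem_range] at hi
      exact Finset.mem_range.2 (hi.1.trans hk1)
    refine le_trans (le_of_eq ?_) (Finset.sum_le_sum_of_subset_of_nonneg hsub fun p _ _ => ?_)
    · rw [Finset.cast_card]
      refine Finset.sum_congr rfl fun p hp => ?_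
      obtain ⟨hp1, hp2, -⟩ := Finset.mem_offDiag.1 hp
      have hd1 := (Finset.mem_filter.1 hp1).2
      have hd2 := (Finset.mem_filter.1 hp2).2
      have : dist (X p.1 ω) (X p.2 ω) ≤ (1 / 256) ^ j := by
        have := dist_triangle_right (X p.1 ω) (X p.2 ω) y
        linarith
      exact (Set.indicator_of_mem (show (X p.1 ω, X p.2 ω) ∈ {q : S × S | dist q.1 q.2 ≤ (1 / 256) ^ j}
        from this) 1).symm
    · rcases closeInd_eq ((1 / 256) ^ j) (X p.1 ω, X p.2 ω) with h | h
      exacts [h.ge, zero_le_one.trans h.ge]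
  have h2 := h1.trans (hk₀ k hk3 j)
  set m : ℝ := (T.card : ℝ) with hm
  have h3 : ((T.offDiag.card : ℕ) : ℝ) = m * m - m := by
    rw [Finset.offDiag_card, Nat.cast_sub (Nat.le_mul_self _), Nat.cast_mul]
  have hk2' : (2 : ℝ) ^ k ≤ 2 * n := by exact_mod_cast hk2
  rw [h3] at h2
  -- With `s = 2 (C + 1) n 2⁻ʲ` and `s ≥ 0`, the bound `m (m - 1) ≤ s ^ 2` forces `m ≤ 1 + s`: if `m
  -- - 1 > s`, then `m (m - 1) ≥ (m - 1) ^ 2 > s ^ 2`.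
  by_contra! hcon
  have h4 : (2 * (C + 1) * n * (1 / 2) ^ j) ^ 2 < (m - 1) ^ 2 :=
    pow_lt_pow_left₀ (by linarith) (by positivity) two_ne_zero
  have h5 : ((2 : ℝ) ^ k) ^ 2 * ((C + 1) * (1 / 4) ^ j) ≤ (2 * (C + 1) * n * (1 / 2) ^ j) ^ 2 := by
    calc ((2 : ℝ) ^ k) ^ 2 * ((C + 1) * (1 / 4) ^ j)
        ≤ (2 * n) ^ 2 * ((C + 1) ^ 2 * (1 / 4) ^ j) := by
          gcongr
          nlinarith
      _ = _ := by
          have : (1 / 4 : ℝ) ^ j = ((1 / 2) ^ j) ^ 2 := by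
            rw [← pow_mul, mul_comm j, pow_mul]; norm_num
          rw [this]; ring
  have h6 : 0 ≤ 2 * (C + 1) * n * (1 / 2 : ℝ) ^ j := by positivity
  nlinarith

end Count

/-! ### Consequences of the penalty conditions. -/

section Penalty

variable {d p : ℕ} {pt : ℕ → ℝ≥0 → ℝ}

lemma CondC2.eventually_le (h : CondC2 pt) {η : ℝ} (hη : 0 < η) :
    ∀ᶠ n : ℕ in atTop, ∀ κ, pt n κ ≤ η * n := by
  obtain ⟨⟨hb, ho⟩, h0⟩ := h
  filter_upwards [hb, ho.bound hη, (h0 0).bound hη] with n h1 h2 h3 κ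
  simp only [Real.norm_eq_abs, Nat.abs_cast] at h2 h3
  -- The supremum in C2 runs over `κ > 0` only; `κ = 0` is covered by the pointwise condition.
  rcases eq_or_ne κ 0 with rfl | hκ
  · exact (le_abs_self _).trans h3
  · exact ((le_max_right 0 _).trans (le_ciSup h1 ⟨κ, pos_iff_ne_zero.2 hκ⟩)).trans
      ((le_abs_self _).trans h2)

lemma constA_pos (hd : 2 ≤ d) : 0 < constA d := by
  have h : (0 : ℝ) < ((d : ℝ) - 1) / 2 := by
    have : (2 : ℝ) ≤ d := by exact_mod_cast hd
    linarith
  have := Real.Gamma_pos_of_pos h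
  unfold constA
  positivity

/-- The penalty compensates a fixed multiple of `log κ`, up to `o(n)`. -/
lemma eventually_mul_log_add_le (hd : 2 ≤ d) {M : ℝ} (hM : 0 < M) (h2 : CondC2 pt)
    (h3 : CondC3 d M pt) (a : ℝ) (ha : 0 ≤ a) {η : ℝ} (hη : 0 < η) :
    ∀ᶠ n : ℕ in atTop, ∀ κ : ℝ≥0, 3 ≤ κ → a * Real.log κ + pt n κ ≤ η * n := by
  have hA := constA_pos hd
  have hlog : Tendsto (fun n : ℕ => Real.log n) atTop atTop :=
    Real.tendsto_log_atTop.comp tendsto_natCast_atTop_atTop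
  filter_upwards [h3, h2.eventually_le (half_pos hη), hlog.eventually_ge_atTop (a + 1),
    tendsto_natCast_atTop_atTop.eventually_ge_atTop (a ^ 2 * (M * constA d) / (η / 2) ^ 2),
    eventually_ge_atTop 1] with n h3 h2 hl hn hn1 κ hκ
  have hn0 : (0 : ℝ) < n := by exact_mod_cast hn1
  have hκ' : (3 : ℝ) ≤ κ := by exact_mod_cast hκ
  have hL : 1 ≤ Real.log κ := by
    rw [Real.le_log_iff_exp_le (by linarith)]
    exact Real.exp_one_lt_three.le.trans hκ'
  set L := Real.log κ with hLdef
  -- In the range of C3 the coefficient `3 (log n) ^ 2` exceeds `a`. Outside it `L ^ 2 ≤ L ^ (2 d -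
  -- 2) ≤ M A₂ n`, so `a * L` is of order `√n`.
  by_cases hc : 1 / L ^ (2 * d - 2) ≤ Real.log n / (M * n * constA d)
  · have := h3 κ (lt_of_lt_of_le (by norm_num) hκ) hc
    have h5 : a ≤ 3 * Real.log n ^ 2 := by nlinarith
    have h6 : a * L ≤ 3 * Real.log n ^ 2 * L := by gcongr
    have : 0 ≤ η * n := by positivity
    linarith
  · push Not at hc
    rw [div_lt_div_iff₀ (by positivity) (by positivity), one_mul] at hc
    have hL2 : L ^ 2 ≤ L ^ (2 * d - 2) := pow_le_pow_right₀ hL (by omega)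
    have hL3 : L ^ 2 ≤ M * constA d * n := by
      have : L ^ (2 * d - 2) ≤ Real.log n * L ^ (2 * d - 2) :=
        le_mul_of_one_le_left (by positivity) (by linarith)
      linarith
    have h7 : (a * L) ^ 2 ≤ (η / 2 * n) ^ 2 := by
      rw [div_le_iff₀ (by positivity)] at hn
      calc (a * L) ^ 2 = a ^ 2 * L ^ 2 := by ring
        _ ≤ a ^ 2 * (M * constA d * n) := by gcongr
        _ = (a ^ 2 * (M * constA d)) * n := by ring
        _ ≤ (n * (η / 2) ^ 2) * n := by gcongr
        _ = _ := by ring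
    have h8 := abs_le_of_sq_le_sq h7 (by positivity)
    have h9 := (le_abs_self _).trans h8
    have := h2 κ
    linarith

end Penalty

/-! ### Components of large concentration. -/

section Tail

variable {d : ℕ} {pt : ℕ → ℝ≥0 → ℝ}

/-- With `κ` between `2 ^ (32 j)` and `2 ^ (32 (j + 1))`, this bounds the density at distance more
than `256⁻ʲ / 2` from its mean direction. -/
lemma tendsto_pow_mul_exp_neg_two_pow (d : ℕ) (a : ℝ) :
    Tendsto (fun j : ℕ => a * ((2 ^ 32) ^ (j + 1)) ^ d * Real.exp (-((2 ^ 16) ^ j / 8)))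
      atTop (𝓝 0) := by
  have hu : Tendsto (fun j : ℕ => ((2 : ℝ) ^ 16) ^ j / 8) atTop atTop :=
    (tendsto_pow_atTop_atTop_of_one_lt (by norm_num)).atTop_div_const (by norm_num)
  have h := ((Real.tendsto_pow_mul_exp_neg_atTop_nhds_zero (2 * d)).comp hu).const_mul
    (a * (2 ^ 32) ^ d * 8 ^ (2 * d))
  rw [mul_zero] at h
  refine h.congr fun j => ?_
  simp only [Function.comp, div_pow]
  have e : (((2 : ℝ) ^ 32) ^ (j + 1)) ^ d = (2 ^ 32) ^ d * (((2 : ℝ) ^ 16) ^ j) ^ (2 * d) := by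
    rw [show (2 : ℝ) ^ 32 = (2 ^ 16) ^ 2 by norm_num]
    generalize (2 : ℝ) ^ 16 = b
    ring
  rw [e]
  field_simp

lemma tendsto_mul_half_pow (a : ℝ) :
    Tendsto (fun j : ℕ => a * ((j + 1) * (1 / 2 : ℝ) ^ j)) atTop (𝓝 0) := by
  have h1 := tendsto_self_mul_const_pow_of_lt_one (r := (1 / 2 : ℝ)) (by norm_num) (by norm_num)
  have h2 := tendsto_pow_atTop_nhds_zero_of_lt_one (r := (1 / 2 : ℝ)) (by norm_num) (by norm_num)
  have h := (h1.add h2).const_mul a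
  simp only [add_zero, mul_zero] at h
  refine h.congr fun j => ?_
  ring

/-- A component with large concentration contributes little to the penalized likelihood. -/
lemma exists_eventually_tail_le (hd : 2 ≤ d) {M : ℝ} (hM : 0 < M) (h2 : CondC2 pt)
    (h3 : CondC3 d M pt) {x : ℕ → Sphere d} {C : ℝ} (hC : 0 ≤ C)
    (hx : ∀ᶠ n : ℕ in atTop, ∀ (j : ℕ) (y : Sphere d),
      (((Finset.range n).filter fun i => dist (x i) y ≤ (1 / 256) ^ j / 2).card : ℝ) ≤
        1 + C * n * (1 / 2) ^ j) {ε η : ℝ} (hε : 0 < ε) (hη : 0 < η) :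
    ∃ K : ℝ≥0, ∀ᶠ n : ℕ in atTop, ∀ θ : Component d, K ≤ θ.2 →
      ∑ i ∈ Finset.range n, Real.log (1 + density θ (x i) / ε) + pt n θ.2 ≤ η * n := by
  obtain ⟨D, hD, hdens⟩ := exists_density_le hd
  have hη3 : 0 < η / 3 := by positivity
  obtain ⟨J, hJ⟩ := eventually_atTop.1
    (((tendsto_pow_mul_exp_neg_two_pow d (D / ε)).eventually_le_const hη3).and
      ((tendsto_mul_half_pow ((d + 1) * 32 * C)).eventually_le_const hη3))
  -- The bound `3` serves the penalty lemma, `(2 ^ 32) ^ J` forces the scale `j ≥ J`, and `1 + D / ε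
  -- ≤ κ` gives `1 + density / ε ≤ κ ^ (d + 1)`.
  refine ⟨max 3 (max ((2 ^ 32) ^ J) (1 + D / ε).toNNReal), ?_⟩
  filter_upwards [hx, eventually_mul_log_add_le hd hM h2 h3 (d + 1) (by positivity) hη3]
    with n hcount hpen θ hK
  obtain ⟨hK1, hK2, hK3⟩ : 3 ≤ θ.2 ∧ (2 ^ 32) ^ J ≤ θ.2 ∧ (1 + D / ε).toNNReal ≤ θ.2 := by
    simpa using hK
  have hpen := hpen θ.2 hK1
  have hdens := hdens θ (le_trans (by norm_num) hK1)
  have hκ3 : (3 : ℝ) ≤ θ.2 := by exact_mod_cast hK1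
  have hκJ : ((2 : ℝ) ^ 32) ^ J ≤ θ.2 := by exact_mod_cast hK2
  have hκD : 1 + D / ε ≤ θ.2 := Real.toNNReal_le_iff_le_coe.1 hK3
  set κ : ℝ := ((θ.2 : ℝ≥0) : ℝ) with hκ
  have hκ0 : 0 < κ := by linarith
  obtain ⟨j, hj1, hj2⟩ := exists_nat_pow_near (by linarith : 1 ≤ κ)
    (by norm_num : (1 : ℝ) < 2 ^ 32)
  have hJj : J ≤ j := by
    by_contra! h
    have : ((2 : ℝ) ^ 32) ^ (j + 1) ≤ (2 ^ 32) ^ J := pow_le_pow_right₀ (by norm_num) h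
    linarith
  obtain ⟨hJ1, hJ2⟩ := hJ j hJj
  have hL0 : 0 ≤ Real.log κ := Real.log_nonneg (by linarith)
  have hL : Real.log κ ≤ 32 * (j + 1) := by
    have h := Real.log_le_log hκ0 hj2.le
    rw [← pow_mul, Real.log_pow] at h
    have h2 := Real.log_two_lt_d9
    have h3 : (((32 * (j + 1) : ℕ)) : ℝ) * Real.log 2 ≤ ((32 * (j + 1) : ℕ) : ℝ) * 1 := by
      gcongr
      linarith
    push_cast at h h3
    linarith
  -- Close observations cost at most `(d + 1) log κ`. For the others the exponent `κ * dist ^ 2 / 2`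
  -- is at least `2 ^ (16 j) / 8`.
  have hterm : ∀ i, Real.log (1 + density θ (x i) / ε) ≤
      (if dist (x i) θ.1 ≤ (1 / 256) ^ j / 2 then (d + 1) * Real.log κ else 0) + η / 3 := by
    intro i
    have hpos : 0 < density θ (x i) / ε := div_pos (density_pos hd _ _) hε
    split_ifs with hclose
    · have h1 : density θ (x i) ≤ D * κ ^ d :=
        (hdens (x i)).trans (mul_le_of_le_one_right (by positivity)
          (Real.exp_le_one_iff.2 (neg_nonpos.2 (by positivity))))
      have h4 : 1 ≤ κ ^ d := one_le_pow₀ (by linarith)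
      have h5 : 1 + density θ (x i) / ε ≤ κ ^ (d + 1) := by
        calc 1 + density θ (x i) / ε ≤ κ ^ d + D * κ ^ d / ε := by gcongr
          _ = κ ^ d * (1 + D / ε) := by ring
          _ ≤ κ ^ d * κ := by gcongr
          _ = _ := (pow_succ _ _).symm
      have h6 := Real.log_le_log (by positivity) h5
      rw [Real.log_pow] at h6
      push_cast at h6
      linarith
    · push Not at hclose
      have h1 := Real.log_le_sub_one_of_pos (by positivity : 0 < 1 + density θ (x i) / ε)
      have h4 : (2 ^ 16 : ℝ) ^ j / 8 ≤ κ * dist (x i) θ.1 ^ 2 / 2 := by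
        have h5 : ((2 : ℝ) ^ 32) ^ j * ((1 / 256) ^ j / 2) ^ 2 ≤ κ * dist (x i) θ.1 ^ 2 := by gcongr
        have h6 : ((2 : ℝ) ^ 32) ^ j * ((1 / 256) ^ j / 2) ^ 2 = (2 ^ 16) ^ j / 4 := by
          rw [div_pow, ← pow_mul (1 / 256 : ℝ), mul_comm j, pow_mul, mul_div_assoc', ← mul_pow]
          norm_num
        linarith
      have h7 : density θ (x i) / ε ≤ η / 3 := by
        refine le_trans ?_ hJ1
        rw [div_le_iff₀ hε]
        calc density θ (x i) ≤ D * κ ^ d * Real.exp (-(κ * dist (x i) θ.1 ^ 2 / 2)) := hdens (x i)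
          _ ≤ D * ((2 ^ 32) ^ (j + 1)) ^ d * Real.exp (-((2 ^ 16) ^ j / 8)) := by gcongr
          _ = _ := by field_simp
      linarith
  have hsum := Finset.sum_le_sum fun i (_ : i ∈ Finset.range n) => hterm i
  rw [Finset.sum_add_distrib, ← Finset.sum_filter, Finset.sum_const, Finset.sum_const,
    Finset.card_range, nsmul_eq_mul, nsmul_eq_mul] at hsum
  have hA : 0 ≤ (d + 1) * Real.log κ := by positivity
  -- The `1` in the count leaves a single `(d + 1) log κ`, which the penalty absorbs; the rest is
  -- controlled by `(j + 1) 2⁻ʲ`.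
  have h8 := mul_le_mul_of_nonneg_right (hcount j θ.1) hA
  have h9 : C * n * (1 / 2) ^ j * ((d + 1) * Real.log κ) ≤ n * (η / 3) := by
    calc C * n * (1 / 2) ^ j * ((d + 1) * Real.log κ)
        ≤ C * n * (1 / 2) ^ j * ((d + 1) * (32 * (j + 1))) := by gcongr
      _ = n * ((d + 1) * 32 * C * ((j + 1) * (1 / 2) ^ j)) := by ring
      _ ≤ _ := by gcongr
  linarith

end Tail
-- A strong law simultaneous over all continuous functions.
section Means

variable {Ω S : Type*} [MeasurableSpace Ω] {P : Measure Ω}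
  [MetricSpace S] [CompactSpace S] [MeasurableSpace S] [BorelSpace S]
  {X : ℕ → Ω → S} {ν : Measure S}

/-- Almost surely the empirical measures converge weakly. -/
lemma ae_forall_tendsto_mean [IsProbabilityMeasure ν] (hX : ∀ i, Measurable (X i))
    (hindep : iIndepFun X P) (hlaw : ∀ i, P.map (X i) = ν) :
    ∀ᵐ ω ∂P, ∀ φ : C(S, ℝ), Tendsto (fun n : ℕ => (∑ i ∈ Finset.range n, φ (X i ω)) / n) atTop
      (𝓝 (∫ y, φ y ∂ν)) := by
  have hintν : ∀ φ : C(S, ℝ), Integrable φ ν := fun φ =>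
    φ.continuous.integrable_of_hasCompactSupport (HasCompactSupport.of_compactSpace _)
  have hslln : ∀ φ : C(S, ℝ), ∀ᵐ ω ∂P,
      Tendsto (fun n : ℕ => (∑ i ∈ Finset.range n, φ (X i ω)) / n) atTop (𝓝 (∫ y, φ y ∂ν)) := by
    intro φ
    have hφ : Measurable φ := φ.continuous.measurable
    have h := strong_law_ae_real (μ := P) (fun i ω => φ (X i ω))
      (Integrable.comp_measurable (by rw [hlaw]; exact hintν φ) (hX 0))
      (fun i j hij => (hindep.indepFun hij).comp hφ hφ)
      (fun i => (IdentDistrib.mk (hX i).aemeasurable (hX 0).aemeasurable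
        ((hlaw i).trans (hlaw 0).symm)).comp hφ)
    have e : ∫ ω, φ (X 0 ω) ∂P = ∫ y, φ y ∂ν := by
      rw [← hlaw 0, integral_map (hX 0).aemeasurable hφ.aestronglyMeasurable]
    rwa [e] at h
  -- Separability of `C(S, ℝ)` reduces to countably many null sets; uniform approximation then
  -- reaches every `φ`.
  have hall := ae_all_iff.2 fun k => hslln (TopologicalSpace.denseSeq C(S, ℝ) k)
  filter_upwards [hall] with ω hω φ
  rw [Metric.tendsto_atTop]
  intro ε hε
  obtain ⟨k, hk⟩ := (TopologicalSpace.denseRange_denseSeq C(S, ℝ)).exists_dist_lt φ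
    (by positivity : 0 < ε / 3)
  set ψ := TopologicalSpace.denseSeq C(S, ℝ) k
  have hψ : ∀ y, |φ y - ψ y| ≤ ε / 3 := fun y => by
    rw [← Real.dist_eq]; exact (ContinuousMap.dist_apply_le_dist y).trans hk.le
  obtain ⟨N, hN⟩ := Metric.tendsto_atTop.1 (hω k) (ε / 3) (by positivity)
  refine ⟨N, fun n hn => ?_⟩
  have h1 := hN n hn
  have h2 : |∫ y, φ y ∂ν - ∫ y, ψ y ∂ν| ≤ ε / 3 := by
    rw [← integral_sub (hintν φ) (hintν ψ)]
    have := norm_integral_le_of_norm_le_const (μ := ν) (f := fun y => φ y - ψ y) (C := ε / 3)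
      (.of_forall hψ)
    simpa using this
  have h3 : |(∑ i ∈ Finset.range n, φ (X i ω)) / n - (∑ i ∈ Finset.range n, ψ (X i ω)) / n| ≤
      ε / 3 := by
    rw [← sub_div, ← Finset.sum_sub_distrib, abs_div, Nat.abs_cast]
    refine div_le_of_le_mul₀ (by positivity) (by positivity)
      ((Finset.abs_sum_le_sum_abs _ _).trans ((Finset.sum_le_sum fun i _ => hψ (X i ω)).trans ?_))
    simp [mul_comm]
  rw [Real.dist_eq, abs_lt] at *
  rw [abs_le] at h2 h3
  constructor <;> linarith

end Means

/-! ### Gibbs' inequality with a Hellinger remainder. -/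

section KullbackLeibler

variable {d : ℕ}

/-- Apply `log t ≤ t - 1` to `t = √(ε + b) / √a`, then `√(ε + b) ≤ √ε + √b` and `2 √a √b = a + b -
(√a - √b) ^ 2`. The square integrates to the Hellinger distance, and the `ε` term vanishes in the
limit. -/
lemma mul_log_sub_log_le {a b ε : ℝ} (ha : 0 < a) (hb : 0 ≤ b) (hε : 0 < ε) :
    a * Real.log (ε + b) - a * Real.log a ≤
      2 * √ε * √a + (b - a) - (√a - √b) ^ 2 := by
  have hc : 0 < ε + b := by positivity
  have h1 := Real.log_le_sub_one_of_pos (by positivity : 0 < √(ε + b) / √a)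
  rw [Real.log_div (by positivity) (by positivity), Real.log_sqrt hc.le, Real.log_sqrt ha.le] at h1
  have h2 : √(ε + b) ≤ √ε + √b := by
    refine Real.sqrt_le_iff.2 ⟨by positivity, ?_⟩
    rw [add_sq, Real.sq_sqrt hε.le, Real.sq_sqrt hb]
    have : 0 ≤ 2 * √ε * √b := by positivity
    linarith
  have h3 := mul_le_mul_of_nonneg_left h1 ha.le
  have h4 : a * (√(ε + b) / √a - 1) = √a * √(ε + b) - a := by
    have h0 : a / √a = √a := Real.div_sqrt
    rw [mul_sub, mul_one, mul_div_assoc', mul_comm a, mul_div_assoc, h0, mul_comm]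
  have h5 := mul_le_mul_of_nonneg_left h2 (Real.sqrt_nonneg a)
  have h6 := Real.sq_sqrt ha.le
  have h7 := Real.sq_sqrt hb
  nlinarith

/-- A density is determined by maximizing the expected log-likelihood. -/
lemma ae_eq_of_integral_mul_log_le {f g : Sphere d → ℝ} (hf : Continuous f) (hg : Continuous g)
    (hf0 : ∀ x, 0 < f x) (hg0 : ∀ x, 0 ≤ g x)
    (hfg : ∫ x, g x ∂(surface d) ≤ ∫ x, f x ∂(surface d))
    (h : ∀ ε > 0, ∫ x, f x * Real.log (f x) ∂(surface d) ≤
      ∫ x, f x * Real.log (ε + g x) ∂(surface d)) : f =ᵐ[surface d] g := by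
  have hlogf : Continuous fun x => Real.log (f x) := hf.log fun x => (hf0 x).ne'
  set H := ∫ x, (√(f x) - √(g x)) ^ 2 ∂(surface d) with hH
  set A := ∫ x, √(f x) ∂(surface d) with hA
  have hA0 : 0 ≤ A := integral_nonneg fun x => Real.sqrt_nonneg _
  have key : ∀ ε > 0, H ≤ 2 * √ε * A := by
    intro ε hε
    have hlogg : Continuous fun x => Real.log (ε + g x) :=
      (continuous_const.add hg).log fun x =>
        (add_pos_of_pos_of_nonneg hε (hg0 x)).ne'
    have h1 : ∫ x, (f x * Real.log (ε + g x) - f x * Real.log (f x)) ∂(surface d) ≤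
        ∫ x, (2 * √ε * √(f x) + (g x - f x) - (√(f x) - √(g x)) ^ 2) ∂(surface d) :=
      integral_mono (integrable_of_continuous_surface (by fun_prop))
        (integrable_of_continuous_surface (by fun_prop))
        fun x => mul_log_sub_log_le (hf0 x) (hg0 x) hε
    rw [integral_sub (integrable_of_continuous_surface (by fun_prop))
        (integrable_of_continuous_surface (by fun_prop)),
      integral_sub (integrable_of_continuous_surface (by fun_prop))
        (integrable_of_continuous_surface (by fun_prop)),
      integral_add (integrable_of_continuous_surface (by fun_prop))
        (integrable_of_continuous_surface (by fun_prop)),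
      integral_sub (integrable_of_continuous_surface hg) (integrable_of_continuous_surface hf),
      integral_const_mul] at h1
    linarith [h ε hε]
  have hH0 : H ≤ 0 := by
    refine le_of_forall_pos_le_add fun δ hδ => ?_
    have h1 := key ((δ / (2 * A + 1)) ^ 2) (by positivity)
    rw [Real.sqrt_sq (by positivity)] at h1
    refine h1.trans ?_
    rw [zero_add, mul_div_assoc', div_mul_eq_mul_div, div_le_iff₀ (by positivity)]
    nlinarith
  have hH1 : H = 0 := le_antisymm hH0 (integral_nonneg fun x => sq_nonneg _)
  have hint : Integrable (fun x => (√(f x) - √(g x)) ^ 2) (surface d) :=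
    integrable_of_continuous_surface ((hf.sqrt.sub hg.sqrt).pow 2)
  rw [hH, integral_eq_zero_iff_of_nonneg (fun x => sq_nonneg _) hint] at hH1
  filter_upwards [hH1] with x hx
  have h1 : √(f x) = √(g x) := by
    simpa [sub_eq_zero] using hx
  exact (Real.sqrt_inj (hf0 x).le (hg0 x)).1 h1

end KullbackLeibler

/-! ### Integrals and ball masses for the mixture distribution. -/

section MixMeasure

variable {d p : ℕ}

lemma integral_mixMeasure (hd : 2 ≤ d) (γ : Param d p) (φ : Sphere d → ℝ) :
    ∫ x, φ x ∂(mixMeasure γ) = ∫ x, mixDensity γ x * φ x ∂(surface d) := by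
  rw [mixMeasure, integral_withDensity_eq_integral_toReal_smul
    (continuous_mixDensity hd γ).measurable.ennreal_ofReal (by simp)]
  simp [ENNReal.toReal_ofReal (mixDensity_pos hd γ _).le]

lemma mixDensity_le_maxDensity (hd : 2 ≤ d) (γ : Param d p) (x : Sphere d) :
    mixDensity γ x ≤ maxDensity γ :=
  le_ciSup (isCompact_range (continuous_mixDensity hd γ)).bddAbove x

lemma maxDensity_pos (hd : 2 ≤ d) (γ : Param d p) : 0 < maxDensity γ := by
  obtain ⟨x⟩ := nonempty_sphere hd
  exact (mixDensity_pos hd γ x).trans_le (mixDensity_le_maxDensity hd γ x)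

lemma mixMeasure_real_le (hd : 2 ≤ d) (γ : Param d p) {s : Set (Sphere d)} (hs : MeasurableSet s) :
    (mixMeasure γ).real s ≤ maxDensity γ * (surface d).real s := by
  rw [measureReal_def, mixMeasure, withDensity_apply _ hs]
  refine ENNReal.toReal_le_of_le_ofReal
    (mul_nonneg (maxDensity_pos hd γ).le measureReal_nonneg) ?_
  calc ∫⁻ x in s, ENNReal.ofReal (mixDensity γ x) ∂(surface d)
      ≤ ∫⁻ _ in s, ENNReal.ofReal (maxDensity γ) ∂(surface d) :=
        lintegral_mono fun x => ENNReal.ofReal_le_ofReal (mixDensity_le_maxDensity hd γ x)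
    _ = _ := by
        rw [setLIntegral_const, ENNReal.ofReal_mul (maxDensity_pos hd γ).le, measureReal_def,
          ENNReal.ofReal_toReal (measure_ne_top _ _)]

lemma exists_mixMeasure_closedBall_le (hd : 2 ≤ d) (γ : Param d p) :
    ∃ C ≥ 0, ∀ (x : Sphere d) (r : ℝ), 0 < r →
      (mixMeasure γ).real (Metric.closedBall x r) ≤ C * r := by
  obtain ⟨C, hC, h⟩ := exists_surface_closedBall_le hd
  have hM := (maxDensity_pos hd γ).le
  refine ⟨maxDensity γ * C, by positivity, fun x r hr => ?_⟩
  refine (mixMeasure_real_le hd γ Metric.isClosed_closedBall.measurableSet).trans ?_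
  rw [mul_assoc]
  exact mul_le_mul_of_nonneg_left (h x r hr) hM

end MixMeasure
-- Splitting the likelihood and passing to the limit.
section Consistency

variable {d p : ℕ}

/-- Expanding the product, the linear terms `a * t i / ε` already dominate `t i`. It turns the
logarithm of a sum into a sum of logarithms, one per diverging component. -/
lemma add_sum_le_mul_prod {ι : Type*} (s : Finset ι) {t : ι → ℝ} (ht : ∀ i, 0 ≤ t i) {a ε : ℝ}
    (hε : 0 < ε) (ha : ε ≤ a) : a + ∑ i ∈ s, t i ≤ a * ∏ i ∈ s, (1 + t i / ε) := by
  classical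
  induction s using Finset.induction_on with
  | empty => simp
  | insert i s hi ih =>
    rw [Finset.sum_insert hi, Finset.prod_insert hi]
    have h1 : 1 ≤ ∏ i ∈ s, (1 + t i / ε) := Finset.one_le_prod fun i _ => by
      have : 0 ≤ t i / ε := div_nonneg (ht i) hε.le
      simpa using this
    have h2 : t i ≤ t i / ε * (a * ∏ i ∈ s, (1 + t i / ε)) := by
      rw [div_mul_eq_mul_div, le_div_iff₀ hε]
      refine mul_le_mul_of_nonneg_left (ha.trans ?_) (ht i)
      exact le_mul_of_one_le_right (hε.le.trans ha) h1
    calc a + (t i + ∑ i ∈ s, t i) = (a + ∑ i ∈ s, t i) + t i := by ring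
      _ ≤ a * ∏ i ∈ s, (1 + t i / ε) + t i / ε * (a * ∏ i ∈ s, (1 + t i / ε)) := add_le_add ih h2
      _ = _ := by ring

/-- Splitting off the components in `B` from the logarithm of a mixture. -/
lemma log_sum_le {ι : Type*} (G B : Finset ι) {w t : ι → ℝ} (hw : ∀ i, 0 ≤ w i)
    (hw1 : ∀ i, w i ≤ 1) (ht : ∀ i, 0 < t i) {ε b : ℝ} (hε : 0 < ε) (hb : 0 ≤ b)
    (hpos : 0 < ∑ i ∈ G, w i * t i + ∑ i ∈ B, w i * t i) :
    Real.log (∑ i ∈ G, w i * t i + ∑ i ∈ B, w i * t i) ≤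
      Real.log (ε + b) + |∑ i ∈ G, w i * t i - b| / ε + ∑ i ∈ B, Real.log (1 + t i / ε) := by
  set a := ∑ i ∈ G, w i * t i with ha
  have ha0 : 0 ≤ a := Finset.sum_nonneg fun i _ => mul_nonneg (hw i) (ht i).le
  have hp : ∀ i, 0 < 1 + t i / ε := fun i => by have := div_pos (ht i) hε; linarith
  have h1 : a + ∑ i ∈ B, w i * t i ≤ (ε + a) * ∏ i ∈ B, (1 + t i / ε) := by
    refine le_trans ?_ (add_sum_le_mul_prod B (fun i => (ht i).le) hε (by linarith : ε ≤ ε + a))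
    have : ∑ i ∈ B, w i * t i ≤ ∑ i ∈ B, t i :=
      Finset.sum_le_sum fun i _ => mul_le_of_le_one_left (ht i).le (hw1 i)
    linarith
  have h2 := Real.log_le_log hpos h1
  rw [Real.log_mul (by positivity) (Finset.prod_pos fun i _ => hp i).ne',
    Real.log_prod fun i _ => (hp i).ne'] at h2
  have h3 : Real.log (ε + a) ≤ Real.log (ε + b) + |a - b| / ε := by
    have h4 := Real.log_le_sub_one_of_pos (by positivity : 0 < (ε + a) / (ε + b))
    rw [Real.log_div (by positivity) (by positivity), div_sub_one (by positivity)] at h4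
    have h5 : (ε + a - (ε + b)) / (ε + b) ≤ |a - b| / ε := by
      calc (ε + a - (ε + b)) / (ε + b) ≤ |a - b| / (ε + b) := by
            gcongr
            exact le_trans (le_of_eq (by ring)) (le_abs_self _)
        _ ≤ |a - b| / ε := by
            gcongr
            linarith
    linarith
  linarith

/-- The density of a component, as a continuous map from the parameters to the continuous
functions on the sphere. -/
noncomputable def densityC (hd : 2 ≤ d) : C(Component d, C(Sphere d, ℝ)) :=
  ContinuousMap.curry ⟨fun q => density q.1 q.2, continuous_density hd⟩

lemma densityC_apply (hd : 2 ≤ d) (θ : Component d) (x : Sphere d) :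
    densityC hd θ x = density θ x := rfl

/-- Equality of densities forces the weights on `G` to sum to one by integration, so the sub-mixture
would be a true mixture with fewer components. -/
lemma HasExactOrder.ne_subMixture (hd : 2 ≤ d) {γ₀ : Param d p} (h : HasExactOrder γ₀)
    {G : Finset (Fin p)} (hG : G ≠ Finset.univ) {w : Fin p → ℝ} (hw : ∀ i, 0 ≤ w i)
    (θ : Fin p → Component d) :
    ¬ mixDensity γ₀ =ᵐ[surface d] fun x => ∑ k ∈ G, w k * density (θ k) x := by
  intro heq
  have hcard : G.card < p := by
    simpa using Finset.card_lt_card (Finset.ssubset_univ_iff.2 hG)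
  have hsum : ∑ k ∈ G, w k = 1 := by
    rw [← integral_sum_density hd G w θ, ← integral_congr_ae heq, integral_mixDensity hd]
  let e : Fin G.card ≃ G := G.equivFin.symm
  have hre : ∀ f : Fin p → ℝ, ∑ k, f (e k) = ∑ k ∈ G, f k := by
    intro f
    rw [e.sum_comp fun k : G => f k, Finset.sum_coe_sort]
  refine h G.card hcard
    (⟨fun k => w (e k), fun k => hw _, (hre w).trans hsum⟩, fun k => θ (e k)) ?_
  refine heq.trans (.of_forall fun x => ?_)
  exact (hre fun k => w k * density (θ k) x).symm

/-- The deterministic core of the consistency proof. -/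
lemma tendsto_of_isMax (hd : 2 ≤ d) (γ₀ : Param d p) (hγ₀ : HasExactOrder γ₀)
    {x : ℕ → Sphere d} {pen : ℕ → (Fin p → ℝ≥0) → ℝ} {pt : ℕ → ℝ≥0 → ℝ}
    (hC1 : CondC1 pen pt) (hC2 : CondC2 pt)
    (hmean : ∀ φ : C(Sphere d, ℝ), Tendsto (fun n : ℕ => (∑ i ∈ Finset.range n, φ (x i)) / n) atTop
      (𝓝 (∫ y, φ y ∂(mixMeasure γ₀))))
    (htail : ∀ ε > 0, ∀ η > 0, ∃ K : ℝ≥0, ∀ᶠ n : ℕ in atTop, ∀ θ : Component d, K ≤ θ.2 →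
      ∑ i ∈ Finset.range n, Real.log (1 + density θ (x i) / ε) + pt n θ.2 ≤ η * n)
    {γhat : ℕ → Param d p}
    (hmax : ∀ᶠ n in atTop, ∀ γ : Param d p, penLogLik pen x n γ ≤ penLogLik pen x n (γhat n)) :
    Tendsto (fun n => (⟦γhat n⟧ : QuotParam d p)) atTop (𝓝 ⟦γ₀⟧) := by
  classical
  rw [tendsto_nhds]
  intro V hV hVmem
  by_contra hnot
  have hfreq : ∃ᶠ n in atTop, (⟦γhat n⟧ : QuotParam d p) ∉ V :=
    fun h => hnot (h.mono fun n hn => not_not.1 hn)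
  have hne : NeBot (atTop ⊓ 𝓟 {n | (⟦γhat n⟧ : QuotParam d p) ∉ V}) :=
    frequently_mem_iff_neBot.1 hfreq
  let 𝒰 : Ultrafilter ℕ := Ultrafilter.of (atTop ⊓ 𝓟 {n | (⟦γhat n⟧ : QuotParam d p) ∉ V})
  have h𝒰le : (𝒰 : Filter ℕ) ≤ atTop ⊓ 𝓟 {n | (⟦γhat n⟧ : QuotParam d p) ∉ V} := Ultrafilter.of_le _
  have h𝒰 : (𝒰 : Filter ℕ) ≤ atTop := h𝒰le.trans inf_le_left
  have h𝒰V : ∀ᶠ n in (𝒰 : Filter ℕ), (⟦γhat n⟧ : QuotParam d p) ∉ V :=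
    le_principal_iff.1 (h𝒰le.trans inf_le_right)
  -- limits along the ultrafilter
  obtain ⟨w, hw⟩ : ∃ w, Tendsto (fun n => (γhat n).1) 𝒰 (𝓝 w) :=
    ⟨_, (𝒰.map fun n => (γhat n).1).le_nhds_lim⟩
  -- Along an ultrafilter, a concentration that does not tend to infinity is eventually bounded,
  -- hence converges.
  let B : Finset (Fin p) := Finset.univ.filter fun l => Tendsto (fun n => ((γhat n).2 l).2) 𝒰 atTop
  let G : Finset (Fin p) := Finset.univ.filter fun l => ¬ Tendsto (fun n => ((γhat n).2 l).2) 𝒰 atTop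
  have hθ : ∀ l, ∃ θ : Component d, l ∈ G → Tendsto (fun n => (γhat n).2 l) 𝒰 (𝓝 θ) := by
    intro l
    by_cases hl : l ∈ G
    · obtain ⟨μ, hμ⟩ : ∃ μ, Tendsto (fun n => ((γhat n).2 l).1) 𝒰 (𝓝 μ) :=
        ⟨_, (𝒰.map fun n => ((γhat n).2 l).1).le_nhds_lim⟩
      obtain ⟨K, hK⟩ : ∃ K, ¬ ∀ᶠ n in (𝒰 : Filter ℕ), K ≤ ((γhat n).2 l).2 := by
        have := (Finset.mem_filter.1 hl).2
        rwa [tendsto_atTop, not_forall] at this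
      rw [← Ultrafilter.eventually_not] at hK
      obtain ⟨κ, -, hκ⟩ := (isCompact_Icc : IsCompact (Set.Icc 0 K)).ultrafilter_le_nhds'
        (𝒰.map fun n => ((γhat n).2 l).2) (show ∀ᶠ n in (𝒰 : Filter ℕ), ((γhat n).2 l).2 ∈ Set.Icc 0 K from
          hK.mono fun n hn => ⟨zero_le, (not_le.1 hn).le⟩)
      have hκ' : Tendsto (fun n => ((γhat n).2 l).2) 𝒰 (𝓝 κ) := hκ
      exact ⟨(μ, κ), fun _ => hμ.prodMk_nhds hκ'⟩
    · exact ⟨γ₀.2 l, fun h => absurd h hl⟩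
  choose θ hθ using hθ
  have hw0 : ∀ l, 0 ≤ (w : Fin p → ℝ) l := w.2.1
  have hwl : ∀ l, Tendsto (fun n => ((γhat n).1 : Fin p → ℝ) l) 𝒰 (𝓝 ((w : Fin p → ℝ) l)) :=
    fun l => ((continuous_apply l).comp continuous_subtype_val).continuousAt.tendsto.comp hw
  let gC : C(Sphere d, ℝ) := ∑ l ∈ G, (w : Fin p → ℝ) l • densityC hd (θ l)
  have hgC : ∀ y, gC y = ∑ l ∈ G, (w : Fin p → ℝ) l * density (θ l) y := fun y => by
    simp [gC, densityC_apply]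
  have hg0 : ∀ y, 0 ≤ gC y := fun y => by
    rw [hgC]
    exact Finset.sum_nonneg fun l _ => mul_nonneg (hw0 l) (density_pos hd _ _).le
  have hconv : Tendsto (fun n => ∑ l ∈ G, ((γhat n).1 : Fin p → ℝ) l • densityC hd ((γhat n).2 l))
      𝒰 (𝓝 gC) :=
    tendsto_finsetSum _ fun l hl =>
      (hwl l).smul (((densityC hd).continuous.tendsto _).comp (hθ l hl))
  have hf0 := continuous_mixDensity hd γ₀
  -- the limit maximizes the expected log-likelihood
  have hKL : mixDensity γ₀ =ᵐ[surface d] gC := by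
    refine ae_eq_of_integral_mul_log_le hf0 gC.continuous (mixDensity_pos hd γ₀) hg0 ?_ ?_
    · simp_rw [hgC]
      rw [integral_sum_density hd, integral_mixDensity hd, ← w.2.2]
      exact Finset.sum_le_sum_of_subset_of_nonneg (Finset.subset_univ _) fun l _ _ => hw0 l
    intro ε hε
    let φ : C(Sphere d, ℝ) := ⟨fun y => Real.log (mixDensity γ₀ y),
      hf0.log fun y => (mixDensity_pos hd γ₀ y).ne'⟩
    let ψ : C(Sphere d, ℝ) := ⟨fun y => Real.log (ε + gC y),
      (continuous_const.add gC.continuous).log fun y => (add_pos_of_pos_of_nonneg hε (hg0 y)).ne'⟩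
    rw [← integral_mixMeasure hd γ₀, ← integral_mixMeasure hd γ₀]
    -- In `1 + 2 p`, the `1` is the uniform error on `G`, one `p` covers tails and penalties of the
    -- estimator's components, and the other the penalty of `γ₀`.
    have hmain : ∀ η > 0, ∫ y, φ y ∂(mixMeasure γ₀) ≤
        ∫ y, ψ y ∂(mixMeasure γ₀) + (1 + 2 * p) * η := by
      intro η hη
      refine le_of_tendsto_of_tendsto ((hmean φ).mono_left h𝒰)
        (((hmean ψ).mono_left h𝒰).add_const _) ?_
      have e1 : ∀ᶠ n in (𝒰 : Filter ℕ), ∀ l ∈ B,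
          ∑ i ∈ Finset.range n, Real.log (1 + density ((γhat n).2 l) (x i) / ε) +
            pt n ((γhat n).2 l).2 ≤ η * n := by
        rw [Filter.eventually_all_finset]
        intro l hl
        obtain ⟨K, hK⟩ := htail ε hε η hη
        filter_upwards [h𝒰 hK, (Finset.mem_filter.1 hl).2.eventually_ge_atTop K] with n h1 h2
        exact h1 _ h2
      have e2 : ∀ᶠ n in (𝒰 : Filter ℕ), ∀ y,
          |∑ l ∈ G, ((γhat n).1 : Fin p → ℝ) l * density ((γhat n).2 l) y - gC y| / ε ≤ η := by
        filter_upwards [(Metric.tendsto_nhds.1 hconv) (η * ε) (by positivity)] with n hn y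
        rw [div_le_iff₀ hε, ← Real.dist_eq]
        refine le_trans (le_of_eq ?_) ((ContinuousMap.dist_apply_le_dist y).trans hn.le)
        simp [densityC_apply]
      have e3 : ∀ᶠ n : ℕ in atTop, ∀ l : Fin p, -(η * n) ≤ pt n (γ₀.2 l).2 := by
        rw [Filter.eventually_all]
        intro l
        filter_upwards [(hC2.2 (γ₀.2 l).2).bound hη] with n hn
        rw [Real.norm_eq_abs, Real.norm_eq_abs, Nat.abs_cast] at hn
        exact (abs_le.1 hn).1
      filter_upwards [e1, e2, h𝒰 e3, h𝒰 (hC2.eventually_le hη), h𝒰 hmax,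
        h𝒰 (eventually_gt_atTop 0)] with n e1 e2 e3 e4 e5 hn
      have hn0 : (0 : ℝ) < n := by exact_mod_cast hn
      have hsplit : ∀ f : Fin p → ℝ, ∑ l, f l = ∑ l ∈ G, f l + ∑ l ∈ B, f l := by
        intro f
        rw [add_comm]
        exact (Finset.sum_filter_add_sum_filter_not _ _ _).symm
      have h5 := e5 γ₀
      simp only [penLogLik, logLik, hC1 n] at h5
      have hlog : ∀ i, Real.log (mixDensity (γhat n) (x i)) ≤ ψ (x i) + η +
          ∑ l ∈ B, Real.log (1 + density ((γhat n).2 l) (x i) / ε) := by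
        intro i
        have hp := mixDensity_pos hd (γhat n) (x i)
        simp only [mixDensity, hsplit] at hp ⊢
        have hwn1 : ∀ l, ((γhat n).1 : Fin p → ℝ) l ≤ 1 := fun l => by
          have h := Finset.single_le_sum (f := ((γhat n).1 : Fin p → ℝ))
            (fun l _ => (γhat n).1.2.1 l) (Finset.mem_univ l)
          exact h.trans (γhat n).1.2.2.le
        have := log_sum_le G B (w := ((γhat n).1 : Fin p → ℝ))
          (t := fun l => density ((γhat n).2 l) (x i)) (γhat n).1.2.1 hwn1
          (fun l => density_pos hd _ _) hε (hg0 (x i)) hp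
        refine this.trans ?_
        have := e2 (x i)
        simp only [ψ, ContinuousMap.coe_mk]
        linarith
      have hsum := Finset.sum_le_sum fun i (_ : i ∈ Finset.range n) => hlog i
      rw [Finset.sum_add_distrib, Finset.sum_add_distrib, Finset.sum_comm] at hsum
      have hB : ∑ l ∈ B, ∑ i ∈ Finset.range n, Real.log (1 + density ((γhat n).2 l) (x i) / ε) +
          ∑ l ∈ B, pt n ((γhat n).2 l).2 ≤ ∑ _l ∈ B, η * n := by
        rw [← Finset.sum_add_distrib]
        exact Finset.sum_le_sum e1
      have hGs : ∑ l ∈ G, pt n ((γhat n).2 l).2 ≤ ∑ _l ∈ G, η * n :=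
        Finset.sum_le_sum fun l _ => e4 _
      have h0s : ∑ _l : Fin p, -(η * n) ≤ ∑ l, pt n (γ₀.2 l).2 :=
        Finset.sum_le_sum fun l _ => e3 l
      have hsp1 := hsplit fun l => pt n ((γhat n).2 l).2
      have hsp2 := hsplit fun _ => η * n
      simp only [Finset.sum_const, Finset.card_univ, Fintype.card_fin, nsmul_eq_mul,
        Finset.card_range] at hsum h0s hsp2 hB hGs
      rw [div_le_iff₀ hn0, add_mul, div_mul_cancel₀ _ hn0.ne']
      have hφ : ∑ i ∈ Finset.range n, φ (x i) =
        ∑ i ∈ Finset.range n, Real.log (mixDensity γ₀ (x i)) := rfl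
      rw [hφ]
      linarith
    refine le_of_forall_pos_le_add fun δ hδ => ?_
    have := hmain (δ / (1 + 2 * p)) (by positivity)
    rwa [mul_div_cancel₀ _ (by positivity)] at this
  -- If nothing diverges, the estimators converge in the parameter space itself, and continuity of
  -- the quotient map brings them into `V`. Otherwise exact order is violated.
  by_cases hG : G = Finset.univ
  · have hγ : Tendsto γhat 𝒰 (𝓝 (w, θ)) :=
      hw.prodMk_nhds (tendsto_pi_nhds.2 fun l => hθ l (hG ▸ Finset.mem_univ l))
    have hclass : (⟦(w, θ)⟧ : QuotParam d p) = ⟦γ₀⟧ := by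
      refine Quotient.sound ?_
      change mixDensity _ =ᵐ[surface d] mixDensity _
      refine (hKL.trans (.of_forall fun y => ?_)).symm
      rw [hgC, hG]
      rfl
    have hev := hγ.eventually ((hV.preimage continuous_quotient_mk').mem_nhds
      (show (⟦(w, θ)⟧ : QuotParam d p) ∈ V from hclass ▸ hVmem))
    obtain ⟨n, h1, h2⟩ := (hev.and h𝒰V).exists
    exact h2 h1
  · exact hγ₀.ne_subMixture hd hG hw0 θ (hKL.trans (.of_forall hgC))

end Consistency
end VMF

theorem theorem2 {d p : ℕ} (hd : 2 ≤ d)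
    {Ω : Type*} [MeasurableSpace Ω] (P : Measure Ω) [IsProbabilityMeasure P]
    (γ₀ : VMF.Param d p) (hγ₀ : VMF.HasExactOrder γ₀)
    (X : ℕ → Ω → VMF.Sphere d) (hX : ∀ i, Measurable (X i)) (hindep : iIndepFun X P)
    (hlaw : ∀ i, P.map (X i) = VMF.mixMeasure γ₀)
    (pen : ℕ → (Fin p → ℝ≥0) → ℝ) (pt : ℕ → ℝ≥0 → ℝ)
    (hC1 : VMF.CondC1 pen pt) (hC2 : VMF.CondC2 pt)
    (hC3 : VMF.CondC3 d (VMF.maxDensity γ₀) pt)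
    (γhat : ℕ → Ω → VMF.Param d p)
    (hmax : ∀ᵐ ω ∂P, ∀ᶠ n in atTop, ∀ γ : VMF.Param d p,
      VMF.penLogLik pen (fun i => X i ω) n γ ≤ VMF.penLogLik pen (fun i => X i ω) n (γhat n ω)) :
    ∀ᵐ ω ∂P, Tendsto (fun n => (⟦γhat n ω⟧ : VMF.QuotParam d p)) atTop (𝓝 ⟦γ₀⟧) := by
  have hν : IsProbabilityMeasure (VMF.mixMeasure γ₀) := by
    rw [← hlaw 0]
    exact Measure.isProbabilityMeasure_map (hX 0).aemeasurable
  obtain ⟨C, hC, hball⟩ := VMF.exists_mixMeasure_closedBall_le hd γ₀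
  filter_upwards [hmax, VMF.ae_forall_tendsto_mean hX hindep hlaw,
    VMF.ae_card_ball_le hX hindep hlaw hC hball] with ω hω hmean hcount
  exact VMF.tendsto_of_isMax hd γ₀ hγ₀ hC1 hC2 hmean
    (fun ε hε η hη => VMF.exists_eventually_tail_le hd (VMF.maxDensity_pos hd γ₀) hC2 hC3
      (by positivity : 0 ≤ 2 * (C + 1))
      hcount hε hη) hω
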